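/- Let $\alpha>0$ and let $\gamma\subset\mathbb{C}$ be a Jordan arc of class $C^{3+\alpha}$ with endpoints $p\neq q$ (for instance $p=-1$, $q=1$); that is, $\gamma=w([-1,1])$ for some injective $C^3$ map $w:[-1,1]\to\mathbb{C}$ with $w(-1)=p$, $w(1)=q$, $w'\neq 0$ on $[-1,1]$ and $w'''$ Hölder continuous with exponent $\alpha$. Let $\nu_e$ be the equilibrium measure of $\gamma$, i.e. the probability measure on $\gamma$ that minimizes the logarithmic energy $I[\mu]=\iint\log|z-w|^{-1}\,d\mu(z)\,d\mu(w)$, let $\mathrm{cap}(\gamma)=e^{-I[\nu_e]}$, and let $z_e:[-1,1]\to\gamma$ be the equilibrium parametrization: the homeomorphism onto $\gamma$ with $z_e(-1)=p$, $z_e(1)=q$ and $$\nu_e(z_e([-1,t]))=\frac1\pi\int_{-1}^t\frac{ds}{\sqrt{1-s^2}},\qquad -1\le t\le 1 .$$ The arc-Grunsky coefficients $a_{kl}\in\mathbb{R}$, $k,l\ge 1$, of $\gamma$ are the coefficients in the expansion $$\log\Big|\frac{z_e(s)-z_e(t)}{s-t}\Big|=\log(2\,\mathrm{cap}(\gamma))-2\sum_{k,l\ge1}a_{kl}T_k(s)T_l(t),$$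 uniform in $s,t\in[-1,1]$, where $T_k$ is the $k$-th Chebyshev polynomial of the first kind; they are given by $$a_{kl}=-\frac{2}{\pi^2}\int_0^\pi\!\!\int_0^\pi\log\Big|\frac{z_e(\cos\theta)-z_e(\cos\phi)}{\cos\theta-\cos\phi}\Big|\cos(k\theta)\cos(l\phi)\,d\phi\,d\theta .$$ Let $b_{kl}=\sqrt{kl}\,a_{kl}$ and let $B$ be the arc-Grunsky operator, i.e. the operator on (real or complex) $\ell^2(\mathbb{Z}_+)$ given by multiplication by the matrix $(b_{kl})_{k,l\ge1}$. Then $$B\ge -I .$$ That is, $\sum_{k,l}(\delta_{kl}+b_{kl})x_kx_l\ge0$ for all finitely supported real sequences $(x_k)_{k\ge1}$, the operator $I+B$ is symmetric and positive semidefinite on $\ell^2(\mathbb{Z}_+)$, and all eigenvalues of $B$ are real and greater than or equal to $-1$. -/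

import Mathlib

open MeasureTheory Set Filter Topology

noncomputable section

namespace ArcGrunsky

/-- `γ` is a Jordan arc of class `C^{m+α}` from `p` to `q`: the image of `[-1, 1]` under an injective
regular parametrization of class `C^m` whose `m`-th derivative is `α`-Hölder on `[-1, 1]`. -/
def IsHolderJordanArc (m : ℕ) (α : ℝ) (p q : ℂ) (γ : Set ℂ) : Prop :=
  ∃ w : ℝ → ℂ,
    ContDiffOn ℝ m w (Icc (-1) 1) ∧
    (∃ C : ℝ, ∀ s ∈ Icc (-1 : ℝ) 1, ∀ t ∈ Icc (-1 : ℝ) 1,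
      ‖iteratedDerivWithin m w (Icc (-1) 1) s - iteratedDerivWithin m w (Icc (-1) 1) t‖
        ≤ C * |s - t| ^ α) ∧
    (∀ t ∈ Icc (-1 : ℝ) 1, derivWithin w (Icc (-1) 1) t ≠ 0) ∧
    InjOn w (Icc (-1) 1) ∧
    w (-1) = p ∧ w 1 = q ∧
    w '' Icc (-1) 1 = γ

/-- The kernel `log (1 / |z - w|)`, with the value `+∞` on the diagonal. -/
def logKernel (z w : ℂ) : EReal := -ENNReal.log (edist z w)

/-- The logarithmic energy `∫∫ log (1 / |z - w|) dμ(z) dμ(w)` with values in the extended reals, as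
the integral of the positive part minus that of the negative part. For a finite measure on a compact
set the latter is finite, so the energy is then well defined in `(-∞, +∞]`. -/
def logEnergy (μ : Measure ℂ) : EReal :=
  ((∫⁻ z, ∫⁻ w, (logKernel z w).toENNReal ∂μ ∂μ : ENNReal) : EReal) -
    ((∫⁻ z, ∫⁻ w, (-logKernel z w).toENNReal ∂μ ∂μ : ENNReal) : EReal)

/-- `μ` is a probability measure on `K`. -/
def IsProbabilityOn (K : Set ℂ) (μ : Measure ℂ) : Prop :=
  IsProbabilityMeasure μ ∧ μ Kᶜ = 0

/-- `ν` is an equilibrium measure of `K`: a minimizer of the logarithmic energy among all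
probability measures on `K`. -/
def IsEquilibriumMeasure (K : Set ℂ) (ν : Measure ℂ) : Prop :=
  IsProbabilityOn K ν ∧ ∀ μ : Measure ℂ, IsProbabilityOn K μ → logEnergy ν ≤ logEnergy μ

/-- The logarithmic capacity: `e^{-I}`, `I` the minimal logarithmic energy. -/
def logCapacity (K : Set ℂ) : ℝ :=
  (EReal.exp (-(⨅ (μ : Measure ℂ) (_ : IsProbabilityOn K μ), logEnergy μ))).toReal

/-- `z` (restricted to `[-1, 1]`) is the equilibrium parametrization of the arc `γ` from `p` to `q`:
it carries the equilibrium measure of `[-1, 1]` to that of `γ`. -/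
def IsEquilibriumParametrization (p q : ℂ) (γ : Set ℂ) (z : ℝ → ℂ) : Prop :=
  ContinuousOn z (Icc (-1) 1) ∧ InjOn z (Icc (-1) 1) ∧ z '' Icc (-1) 1 = γ ∧
    z (-1) = p ∧ z 1 = q ∧
    ∃ ν : Measure ℂ, IsEquilibriumMeasure γ ν ∧ ∀ t ∈ Icc (-1 : ℝ) 1,
      ν (z '' Icc (-1) t) =
        ENNReal.ofReal (1 / Real.pi * ∫ s in (-1 : ℝ)..t, 1 / Real.sqrt (1 - s ^ 2))

/-- The real numbers `a k l`, `k, l ≥ 1`, are the coefficients of an arc-Grunsky expansion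
`log |(z s - z t) / (s - t)| = log (2 cap γ) - 2 ∑ a k l T_k(s) T_l(t)`,
converging uniformly in `s, t ∈ [-1, 1]` (off the diagonal, where the quotient is defined). -/
def IsArcGrunskyExpansion (γ : Set ℂ) (z : ℝ → ℂ) (a : ℕ+ → ℕ+ → ℝ) : Prop :=
  ∃ S : ℝ × ℝ → ℝ,
    HasSumUniformlyOn
      (fun (kl : ℕ+ × ℕ+) (st : ℝ × ℝ) =>
        a kl.1 kl.2 * (Polynomial.Chebyshev.T ℝ (kl.1 : ℕ)).eval st.1 *
          (Polynomial.Chebyshev.T ℝ (kl.2 : ℕ)).eval st.2)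
      S {st | st.1 ∈ Icc (-1) 1 ∧ st.2 ∈ Icc (-1) 1 ∧ st.1 ≠ st.2} ∧
    ∀ s ∈ Icc (-1 : ℝ) 1, ∀ t ∈ Icc (-1 : ℝ) 1, s ≠ t →
      Real.log ‖(z s - z t) / ((s : ℂ) - (t : ℂ))‖
        = Real.log (2 * logCapacity γ) - 2 * S (s, t)

/-- The arc-Grunsky coefficients of the equilibrium parametrization `z`, as the Chebyshev
coefficients of `log |(z s - z t) / (s - t)|` (here `s = cos θ`, `t = cos φ`). -/
def arcGrunskyCoeff (z : ℝ → ℂ) (k l : ℕ+) : ℝ :=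
  -(2 / Real.pi ^ 2) * ∫ θ in (0 : ℝ)..Real.pi, ∫ φ in (0 : ℝ)..Real.pi,
    Real.log ‖(z (Real.cos θ) - z (Real.cos φ)) / ((Real.cos θ : ℂ) - (Real.cos φ : ℂ))‖ *
      Real.cos ((k : ℕ) * θ) * Real.cos ((l : ℕ) * φ)

/-- The entries `b k l = √(k l) a k l` of the arc-Grunsky matrix. -/
def arcGrunskyMatrix (z : ℝ → ℂ) (k l : ℕ+) : ℝ :=
  Real.sqrt (((k : ℕ) : ℝ) * ((l : ℕ) : ℝ)) * arcGrunskyCoeff z k l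

/-- `B` is the arc-Grunsky operator on `ℓ²(ℤ₊)`: the action of the arc-Grunsky matrix by matrix
multiplication. -/
def IsArcGrunskyOperator {𝕜 : Type*} [RCLike 𝕜] (z : ℝ → ℂ)
    (B : lp (fun _ : ℕ+ => 𝕜) 2 →ₗ[𝕜] lp (fun _ : ℕ+ => 𝕜) 2) : Prop :=
  ∀ (x : lp (fun _ : ℕ+ => 𝕜) 2) (k : ℕ+),
    HasSum (fun l : ℕ+ => (arcGrunskyMatrix z k l : 𝕜) * x l) (B x k)

end ArcGrunsky

end

namespace ArcGrunsky

/-! The matrix `I + B` is a Gram-type matrix for logarithmic energy. With `s = cos θ`, `t = cos φ`,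
the kernel `log |s - t|` is diagonal in the cosines: its `(k, l)` coefficient is `-π² / (2k)` if `k
= l` and `0` otherwise (`integral_log_abs_cos_sub_cos_mul_cos_mul_cos`). Splitting `log |z s - z t|`
into the logarithm of the difference quotient plus `log |s - t|` therefore turns the first term into
`b k l` and the second into `δ k l` (`one_add_arcGrunskyMatrix_eq`). Hence `∑ (δ + b) x x` is `2 /
π²` times the logarithmic energy of the charge on the arc with density `f = ∑ √k x_k cos kθ` in the
parameter `θ`.

As `k ≥ 1`, this charge has total mass zero, and such charges have nonnegative energy
(`integral_mul_mul_log_norm_sub_nonpos`): by Frullani, `-log |z - w|² = ∫ (exp (-t |z - w|²) - exp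
(-t)) dt / t`, where the Gaussian is positive definite and the constant `exp (-t)` integrates to
zero against the charge.

Convergence of the integrals rests on the equilibrium measure having finite energy. A regular arc is
bi-Lipschitz to a segment, so some measure on it has finite energy, and the minimizer does no worse
(`lintegral_logKernel_lt_top`); `θ ↦ z (cos θ)` carries Lebesgue measure on `(0, π]` to `π ν`
(`map_comp_cos_eq`). The operator statement follows by truncation, once a matrix acting on all of
`ℓ²` is known to be bounded. -/

/-! ### Positive definiteness of the Gaussian kernel -/

lemma integrable_exp_neg_mul_sq_norm {b : ℝ} (hb : 0 < b) :
    Integrable (fun v : ℂ => Real.exp (-b * ‖v‖ ^ 2)) := by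
  have h := GaussianFourier.integrable_cexp_neg_mul_sq_norm_add (V := ℂ) (b := (b : ℂ))
    (by simpa using hb) 0 0
  refine h.norm.congr (Eventually.of_forall fun v => ?_)
  simp only [Complex.norm_exp]
  congr 1
  simp [← Complex.ofReal_pow]

/-- The parallelogram law about the midpoint of `z` and `w`. Integrated over `u`, it exhibits the
Gaussian as a superposition of product kernels. -/
lemma gaussian_mul_gaussian (t : ℝ) (z w u : ℂ) :
    Real.exp (-(2 * t) * ‖z - u‖ ^ 2) * Real.exp (-(2 * t) * ‖w - u‖ ^ 2) =
      Real.exp (-t * ‖z - w‖ ^ 2) * Real.exp (-(4 * t) * ‖u - (z + w) / 2‖ ^ 2) := by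
  rw [← Real.exp_add, ← Real.exp_add]
  congr 1
  simp only [← Complex.normSq_eq_norm_sq, Complex.normSq_apply]
  simp
  ring

lemma integrable_gaussian_mul_gaussian {t : ℝ} (ht : 0 < t) (z w : ℂ) :
    Integrable fun u : ℂ =>
      Real.exp (-(2 * t) * ‖z - u‖ ^ 2) * Real.exp (-(2 * t) * ‖w - u‖ ^ 2) := by
  simp_rw [gaussian_mul_gaussian]
  exact ((integrable_exp_neg_mul_sq_norm (by positivity : 0 < 4 * t)).comp_sub_right
    ((z + w) / 2)).const_mul _

lemma integral_gaussian_mul_gaussian (t : ℝ) (z w : ℂ) :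
    ∫ u : ℂ, Real.exp (-(2 * t) * ‖z - u‖ ^ 2) * Real.exp (-(2 * t) * ‖w - u‖ ^ 2) =
      Real.exp (-t * ‖z - w‖ ^ 2) * ∫ v : ℂ, Real.exp (-(4 * t) * ‖v‖ ^ 2) := by
  simp_rw [gaussian_mul_gaussian]
  rw [integral_const_mul,
    integral_sub_right_eq_self (fun v : ℂ => Real.exp (-(4 * t) * ‖v‖ ^ 2))]

section PositiveDefinite

variable {Ω : Type*} [MeasurableSpace Ω] {μ : Measure Ω} {Z : Ω → ℂ}
  {f : Ω → ℝ} {M : ℝ}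

lemma integrable_mul_mul_of_bound [SFinite μ] (hf : Measurable f) (hfM : ∀ x, |f x| ≤ M)
    {g : Ω × Ω → ℝ} (hg : Integrable g (μ.prod μ)) :
    Integrable (fun p : Ω × Ω => f p.1 * f p.2 * g p) (μ.prod μ) := by
  refine hg.bdd_mul (c := M * M) (by fun_prop) (Eventually.of_forall fun p => ?_)
  rw [norm_mul]
  exact mul_le_mul (hfM _) (hfM _) (norm_nonneg _) ((abs_nonneg _).trans (hfM p.1))

variable [IsFiniteMeasure μ]

lemma integrable_gaussian (hZ : Measurable Z) {t : ℝ} (ht : 0 < t) :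
    Integrable (fun p : Ω × Ω => Real.exp (-t * ‖Z p.1 - Z p.2‖ ^ 2)) (μ.prod μ) := by
  refine Integrable.of_bound (C := 1) (by fun_prop) (Eventually.of_forall fun p => ?_)
  rw [Real.norm_eq_abs, abs_of_pos (Real.exp_pos _), Real.exp_le_one_iff]
  have : 0 ≤ t * ‖Z p.1 - Z p.2‖ ^ 2 := by positivity
  linarith

/-- The Gaussian kernel is positive definite. -/
lemma gaussian_energy_nonneg (hZ : Measurable Z) (hf : Measurable f) (hfM : ∀ x, |f x| ≤ M)
    {t : ℝ} (ht : 0 < t) :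
    0 ≤ ∫ p : Ω × Ω, f p.1 * f p.2 * Real.exp (-t * ‖Z p.1 - Z p.2‖ ^ 2) ∂(μ.prod μ) := by
  set C : ℝ := ∫ v : ℂ, Real.exp (-(4 * t) * ‖v‖ ^ 2) with hC
  have hCpos : 0 < C := by
    rw [hC, GaussianFourier.integral_rexp_neg_mul_sq_norm (by positivity)]
    positivity
  refine nonneg_of_mul_nonneg_left ?_ hCpos
  -- After Fubini, the inner integral for fixed `u` factors into a square.
  have hswap : (∫ p : Ω × Ω, f p.1 * f p.2 * Real.exp (-t * ‖Z p.1 - Z p.2‖ ^ 2) ∂(μ.prod μ)) * C =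
      ∫ u : ℂ, ∫ p : Ω × Ω, f p.1 * f p.2 * (Real.exp (-(2 * t) * ‖Z p.1 - u‖ ^ 2) *
        Real.exp (-(2 * t) * ‖Z p.2 - u‖ ^ 2)) ∂(μ.prod μ) := by
    rw [← integral_mul_const, ← integral_integral_swap]
    · refine integral_congr_ae (Eventually.of_forall fun p => ?_)
      simp only
      rw [integral_const_mul, integral_gaussian_mul_gaussian, mul_assoc]
    · rw [integrable_prod_iff]
      · constructor
        · exact Eventually.of_forall fun p =>
            (integrable_gaussian_mul_gaussian ht (Z p.1) (Z p.2)).const_mul (f p.1 * f p.2)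
        · have h := ((integrable_mul_mul_of_bound hf hfM
            (integrable_gaussian (μ := μ) hZ ht)).norm).mul_const C
          refine h.congr (Eventually.of_forall fun p => ?_)
          simp only [Function.uncurry, norm_mul, Real.norm_eq_abs, Real.abs_exp]
          rw [integral_const_mul, integral_gaussian_mul_gaussian, mul_assoc]
      · refine Measurable.aestronglyMeasurable ?_
        simp only [Function.uncurry_def]
        fun_prop
  rw [hswap]
  refine integral_nonneg fun u => ?_
  have : ∀ p : Ω × Ω, f p.1 * f p.2 * (Real.exp (-(2 * t) * ‖Z p.1 - u‖ ^ 2) *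
        Real.exp (-(2 * t) * ‖Z p.2 - u‖ ^ 2)) =
      (f p.1 * Real.exp (-(2 * t) * ‖Z p.1 - u‖ ^ 2)) *
        (f p.2 * Real.exp (-(2 * t) * ‖Z p.2 - u‖ ^ 2)) := fun p => by ring
  simp only [this]
  rw [integral_prod_mul (fun x => f x * Real.exp (-(2 * t) * ‖Z x - u‖ ^ 2))
    (fun x => f x * Real.exp (-(2 * t) * ‖Z x - u‖ ^ 2))]
  exact mul_self_nonneg _

/-! ### Frullani's integral and the logarithmic kernel -/

/-- From `1 - exp (-x) ≤ x`, applied to the gap between the two exponents. It gives an integrable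
majorant without singularity at `0`. -/
lemma abs_exp_neg_sub_exp_neg_le {a t : ℝ} (ht : 0 < t) :
    |t⁻¹ * (Real.exp (-(a * t)) - Real.exp (-(1 * t)))| ≤
      |a - 1| * Real.exp (-(min a 1) * t) := by
  have key : ∀ x y : ℝ, x ≤ y → |Real.exp (-(x * t)) - Real.exp (-(y * t))| ≤
      (y - x) * t * Real.exp (-x * t) := by
    intro x y hxy
    have h1 : Real.exp (-(y * t)) ≤ Real.exp (-(x * t)) :=
      Real.exp_le_exp.2 (neg_le_neg (mul_le_mul_of_nonneg_right hxy ht.le))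
    rw [abs_of_nonneg (sub_nonneg.2 h1)]
    have h2 : Real.exp (-(y * t)) = Real.exp (-(x * t)) * Real.exp (-((y - x) * t)) := by
      rw [← Real.exp_add]; congr 1; ring
    have h3 := Real.add_one_le_exp (-((y - x) * t))
    have h4 := Real.exp_pos (-(x * t))
    rw [neg_mul x t, h2]
    nlinarith
  rw [abs_mul, abs_of_pos (inv_pos.2 ht), inv_mul_le_iff₀ ht]
  rcases le_total a 1 with h | h
  · rw [min_eq_left h, abs_of_nonpos (sub_nonpos.2 h)]
    refine (key a 1 h).trans (le_of_eq ?_)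
    ring
  · rw [min_eq_right h, abs_of_nonneg (sub_nonneg.2 h), abs_sub_comm]
    refine (key 1 a h).trans (le_of_eq ?_)
    ring

lemma integrableOn_frullani_exp {a : ℝ} (ha : 0 < a) :
    IntegrableOn (fun t : ℝ => t⁻¹ * (Real.exp (-(a * t)) - Real.exp (-(1 * t)))) (Ioi 0) := by
  refine Integrable.mono' (g := fun t => |a - 1| * Real.exp (-(min a 1) * t))
    ((exp_neg_integrableOn_Ioi 0 (lt_min ha one_pos)).const_mul _) (by fun_prop) ?_
  filter_upwards [ae_restrict_mem measurableSet_Ioi] with t ht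
  exact abs_exp_neg_sub_exp_neg_le ht

lemma integral_frullani_exp {a : ℝ} (ha : 0 < a) :
    ∫ t in Ioi (0 : ℝ), t⁻¹ * (Real.exp (-(a * t)) - Real.exp (-(1 * t))) = -Real.log a := by
  have h := Frullani.integral_Ioi_eq (f := fun x : ℝ => Real.exp (-x)) (a := a) (b := 1)
    (L := 1) (R := 0) ((by fun_prop : Continuous fun x : ℝ => Real.exp (-x)).locallyIntegrable
      |>.locallyIntegrableOn _) ha one_pos ?_ Real.tendsto_exp_neg_atTop_nhds_zero
      (integrableOn_frullani_exp ha)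
  · simpa using h
  · have : Tendsto (fun x : ℝ => Real.exp (-x)) (𝓝 0) (𝓝 (Real.exp (-0))) :=
      (by fun_prop : Continuous fun x : ℝ => Real.exp (-x)).tendsto 0
    simp only [neg_zero, Real.exp_zero] at this
    exact this.mono_left nhdsWithin_le_nhds

/-- The integrand has constant sign, decided by `a ≤ 1` or `1 ≤ a`. Thus integrability of the
logarithm is exactly what Fubini needs below. -/
lemma integral_abs_frullani_exp {a : ℝ} (ha : 0 < a) :
    ∫ t in Ioi (0 : ℝ), |t⁻¹ * (Real.exp (-(a * t)) - Real.exp (-(1 * t)))| = |Real.log a| := by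
  rw [← abs_neg (Real.log a), ← integral_frullani_exp ha]
  rcases le_total a 1 with h | h
  · rw [abs_of_nonneg]
    · refine setIntegral_congr_fun measurableSet_Ioi fun t (ht : 0 < t) => abs_of_nonneg ?_
      exact mul_nonneg (inv_nonneg.2 ht.le) (sub_nonneg.2 (Real.exp_le_exp.2
        (neg_le_neg (mul_le_mul_of_nonneg_right h ht.le))))
    · rw [integral_frullani_exp ha]
      exact neg_nonneg.2 (Real.log_nonpos ha.le h)
  · rw [abs_of_nonpos, ← integral_neg]
    · refine setIntegral_congr_fun measurableSet_Ioi fun t (ht : 0 < t) => abs_of_nonpos ?_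
      exact mul_nonpos_of_nonneg_of_nonpos (inv_nonneg.2 ht.le) (sub_nonpos.2 (Real.exp_le_exp.2
        (neg_le_neg (mul_le_mul_of_nonneg_right h ht.le))))
    · rw [integral_frullani_exp ha]
      exact neg_nonpos.2 (Real.log_nonneg h)

/-- The logarithmic kernel is conditionally positive definite: a signed measure of total mass zero
has nonnegative logarithmic energy. -/
lemma integral_mul_mul_log_norm_sub_nonpos (hZ : Measurable Z) (hf : Measurable f)
    (hfM : ∀ x, |f x| ≤ M) (hf0 : ∫ x, f x ∂μ = 0)
    (hne : ∀ᵐ p ∂(μ.prod μ), Z p.1 ≠ Z p.2)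
    (hint : Integrable (fun p : Ω × Ω => Real.log ‖Z p.1 - Z p.2‖) (μ.prod μ)) :
    ∫ p : Ω × Ω, f p.1 * f p.2 * Real.log ‖Z p.1 - Z p.2‖ ∂(μ.prod μ) ≤ 0 := by
  let h : Ω × Ω → ℝ → ℝ := fun p t =>
    t⁻¹ * (Real.exp (-(‖Z p.1 - Z p.2‖ ^ 2 * t)) - Real.exp (-(1 * t)))
  have hpos : ∀ᵐ p ∂(μ.prod μ), 0 < ‖Z p.1 - Z p.2‖ ^ 2 := by
    filter_upwards [hne] with p hp
    have := norm_pos_iff.2 (sub_ne_zero.2 hp)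
    positivity
  have hintff := integrable_mul_mul_of_bound hf hfM hint
  have hswap : ∫ p : Ω × Ω, f p.1 * f p.2 * (-(2 * Real.log ‖Z p.1 - Z p.2‖)) ∂(μ.prod μ) =
      ∫ t in Ioi (0 : ℝ), ∫ p : Ω × Ω, f p.1 * f p.2 * h p t ∂(μ.prod μ) := by
    rw [← integral_integral_swap]
    · refine integral_congr_ae ?_
      filter_upwards [hpos] with p hp
      rw [integral_const_mul, integral_frullani_exp hp, Real.log_pow]
      norm_num
    · rw [integrable_prod_iff]
      · constructor
        · filter_upwards [hpos] with p hp
          exact (integrableOn_frullani_exp hp).const_mul (f p.1 * f p.2)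
        · refine (hintff.norm.const_mul 2).congr ?_
          filter_upwards [hpos] with p hp
          simp only [Function.uncurry, norm_mul, Real.norm_eq_abs, h]
          rw [integral_const_mul]
          simp_rw [← abs_mul (_ : ℝ)⁻¹]
          rw [integral_abs_frullani_exp hp, Real.log_pow, abs_mul]
          norm_num
          ring
      · refine Measurable.aestronglyMeasurable ?_
        simp only [Function.uncurry_def, h]
        fun_prop
  have hnonneg : 0 ≤ ∫ t in Ioi (0 : ℝ), ∫ p : Ω × Ω, f p.1 * f p.2 * h p t ∂(μ.prod μ) := by
    refine setIntegral_nonneg measurableSet_Ioi fun t (ht : 0 < t) => ?_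
    have hsplit : ∀ p : Ω × Ω, f p.1 * f p.2 * h p t =
        t⁻¹ * (f p.1 * f p.2 * Real.exp (-t * ‖Z p.1 - Z p.2‖ ^ 2)) -
          t⁻¹ * Real.exp (-t) * (f p.1 * f p.2) := fun p => by
      simp only [h, one_mul]
      rw [show -(‖Z p.1 - Z p.2‖ ^ 2 * t) = -t * ‖Z p.1 - Z p.2‖ ^ 2 by ring]
      ring
    simp only [hsplit]
    -- The subtracted `exp (-t)` contributes a multiple of `(∫ f)² = 0`; only here does mass zero
    -- enter.
    rw [integral_sub, integral_const_mul, integral_const_mul, integral_prod_mul f f, hf0]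
    · have := gaussian_energy_nonneg (μ := μ) hZ hf hfM ht
      have := mul_nonneg (inv_nonneg.2 ht.le) this
      simpa using this
    · exact (integrable_mul_mul_of_bound hf hfM (integrable_gaussian hZ ht)).const_mul _
    · have := integrable_mul_mul_of_bound (μ := μ) hf hfM (integrable_const (1 : ℝ))
      simp only [mul_one] at this
      exact this.const_mul _
  rw [← hswap] at hnonneg
  have : ∀ p : Ω × Ω, f p.1 * f p.2 * (-(2 * Real.log ‖Z p.1 - Z p.2‖)) =
      (-2) * (f p.1 * f p.2 * Real.log ‖Z p.1 - Z p.2‖) := fun p => by ring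
  simp only [this] at hnonneg
  rw [integral_const_mul] at hnonneg
  linarith

end PositiveDefinite

/-! ### Fourier coefficients of `log |2 sin (x / 2)|` -/

lemma sin_nat_mul_eq (l : ℕ) (x : ℝ) :
    Real.sin (l * x) =
      Real.sin (x / 2) * ∑ j ∈ Finset.range l, 2 * Real.cos ((2 * j + 1) * (x / 2)) := by
  induction l with
  | zero => simp
  | succ l ih =>
    rw [Finset.sum_range_succ, mul_add, ← ih]
    have h := Real.sin_sub_sin (((l + 1 : ℕ) : ℝ) * x) (l * x)
    push_cast at h ⊢
    rw [show ((l + 1) * x - l * x) / 2 = x / 2 by ring,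
      show ((l + 1) * x + l * x) / 2 = (2 * l + 1) * (x / 2) by ring] at h
    linarith

lemma integral_cos_nat_mul_zero_two_pi (j : ℕ) :
    ∫ x in (0 : ℝ)..(2 * Real.pi), Real.cos (j * x) = if j = 0 then 2 * Real.pi else 0 := by
  split_ifs with h
  · simp [h]
  · have hj : (j : ℝ) ≠ 0 := Nat.cast_ne_zero.2 h
    rw [intervalIntegral.integral_comp_mul_left _ hj, integral_cos]
    simp [show (j : ℝ) * (2 * Real.pi) = ((2 * j : ℕ) : ℝ) * Real.pi by push_cast; ring,
      Real.sin_nat_mul_pi, -Nat.cast_mul]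

lemma intervalIntegrable_log_two_mul_sin_half (a b : ℝ) :
    IntervalIntegrable (fun x => Real.log (2 * Real.sin (x / 2))) volume a b := by
  refine MeromorphicOn.intervalIntegrable_log (f := fun x => 2 * Real.sin (x / 2)) ?_
  intro x _
  exact AnalyticAt.meromorphicAt (by fun_prop)

/-- The Fourier cosine coefficients of `log |1 - e^{ix}|`. -/
lemma integral_log_two_mul_sin_half_mul_cos {l : ℕ} (hl : l ≠ 0) :
    ∫ x in (0 : ℝ)..(2 * Real.pi), Real.log (2 * Real.sin (x / 2)) * Real.cos (l * x) =
      -(Real.pi / l) := by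
  have hl' : (l : ℝ) ≠ 0 := Nat.cast_ne_zero.2 hl
  -- `D x = cot (x / 2) sin (l x)` appears on integrating by parts; only its constant term, from `j
  -- = 0`, has nonzero integral over a period.
  let D : ℝ → ℝ := fun x => ∑ j ∈ Finset.range l, (Real.cos ((j + 1 : ℕ) * x) + Real.cos (j * x))
  have hD : ∀ x, Real.cos (x / 2) * Real.sin (l * x) = Real.sin (x / 2) * D x := by
    intro x
    rw [sin_nat_mul_eq, mul_left_comm, Finset.mul_sum]
    congr 1
    refine Finset.sum_congr rfl fun j _ => ?_
    rw [Real.cos_add_cos, show ((j + 1 : ℕ) * x + j * x) / 2 = (2 * j + 1) * (x / 2) by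
      push_cast; ring, show ((j + 1 : ℕ) * x - j * x) / 2 = x / 2 by push_cast; ring]
    ring
  have hDint : ∫ x in (0 : ℝ)..(2 * Real.pi), D x = 2 * Real.pi := by
    simp only [D]
    rw [intervalIntegral.integral_finsetSum
      (fun j _ => (by fun_prop : Continuous _).intervalIntegrable _ _)]
    have : ∀ j ∈ Finset.range l, ∫ x in (0 : ℝ)..(2 * Real.pi),
        (Real.cos ((j + 1 : ℕ) * x) + Real.cos (j * x)) = if j = 0 then 2 * Real.pi else 0 := by
      intro j _
      rw [intervalIntegral.integral_add ((by fun_prop : Continuous _).intervalIntegrable _ _)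
        ((by fun_prop : Continuous _).intervalIntegrable _ _), integral_cos_nat_mul_zero_two_pi,
        integral_cos_nat_mul_zero_two_pi]
      simp
    rw [Finset.sum_congr rfl this]
    simp [Nat.pos_of_ne_zero hl]
  have hg : IntervalIntegrable
      (fun x => Real.log (2 * Real.sin (x / 2)) * Real.cos (l * x)) volume 0 (2 * Real.pi) :=
    (intervalIntegrable_log_two_mul_sin_half _ _).mul_continuousOn
      (by fun_prop : Continuous _).continuousOn
  have hDi : IntervalIntegrable (fun x => D x / (2 * l)) volume 0 (2 * Real.pi) :=
    (by fun_prop : Continuous _).intervalIntegrable _ _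
  have hF := intervalIntegral.integral_eq_sub_of_hasDerivAt_of_le
    (f := fun x => Real.log (2 * Real.sin (x / 2)) * (Real.sin (l * x) / l))
    (f' := fun x => Real.log (2 * Real.sin (x / 2)) * Real.cos (l * x) + D x / (2 * l))
    (a := 0) (b := 2 * Real.pi) (by positivity) ?_ ?_ (hg.add hDi)
  · rw [intervalIntegral.integral_add hg hDi, intervalIntegral.integral_div, hDint] at hF
    simp at hF
    rw [eq_neg_of_add_eq_zero_left hF]
    field_simp
  · refine Continuous.continuousOn ?_
    -- Dividing `sin (l x)` by `sin (x / 2)` leaves `y log y` times a trigonometric polynomial,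
    -- which is continuous up to the endpoints and vanishes there.
    have : (fun x => Real.log (2 * Real.sin (x / 2)) * (Real.sin (l * x) / l)) = fun x =>
        ((2 * Real.sin (x / 2)) * Real.log (2 * Real.sin (x / 2))) *
          ((∑ j ∈ Finset.range l, 2 * Real.cos ((2 * j + 1) * (x / 2))) / (2 * l)) := by
      funext x
      rw [sin_nat_mul_eq]
      field_simp
    rw [this]
    exact (Real.continuous_mul_log.comp (by fun_prop : Continuous fun x => 2 * Real.sin (x / 2))).mul
      (by fun_prop)
  · intro x hx
    have hs : 0 < Real.sin (x / 2) :=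
      Real.sin_pos_of_pos_of_lt_pi (by linarith [hx.1]) (by linarith [hx.2])
    have h1 : HasDerivAt (fun x : ℝ => 2 * Real.sin (x / 2)) (2 * (Real.cos (x / 2) * (1 / 2))) x :=
      ((hasDerivAt_id x).div_const 2).sin.const_mul 2
    have h2 : HasDerivAt (fun x : ℝ => Real.sin (l * x) / l)
        (Real.cos (l * x) * (l * 1) / l) x :=
      (((hasDerivAt_id x).const_mul (l : ℝ)).sin).div_const _
    convert! (h1.log (by positivity)).mul h2 using 1
    have := hD x
    rw [mul_comm (l : ℝ) x] at this ⊢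
    field_simp
    linarith

lemma integral_log_two_mul_sin_half_mul_sin (l : ℕ) :
    ∫ x in (0 : ℝ)..(2 * Real.pi), Real.log (2 * Real.sin (x / 2)) * Real.sin (l * x) = 0 := by
  have h := intervalIntegral.integral_comp_sub_left (a := 0) (b := 2 * Real.pi)
    (fun x => Real.log (2 * Real.sin (x / 2)) * Real.sin (l * x)) (2 * Real.pi)
  simp only [sub_self, sub_zero] at h
  have h2 : ∀ x : ℝ, Real.log (2 * Real.sin ((2 * Real.pi - x) / 2)) *
      Real.sin (l * (2 * Real.pi - x)) =
      -(Real.log (2 * Real.sin (x / 2)) * Real.sin (l * x)) := by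
    intro x
    rw [show (2 * Real.pi - x) / 2 = Real.pi - x / 2 by ring, Real.sin_pi_sub,
      show l * (2 * Real.pi - x) = -(l * x) + l * (2 * Real.pi) by ring,
      Real.sin_add_nat_mul_two_pi, Real.sin_neg]
    ring
  simp only [h2] at h
  rw [intervalIntegral.integral_neg] at h
  linarith

/-- The sine changes sign over `2π`, but `Real.log` depends only on the absolute value. -/
lemma periodic_log_two_mul_sin_half :
    Function.Periodic (fun x => Real.log (2 * Real.sin (x / 2))) (2 * Real.pi) := by
  intro x
  simp only
  rw [show (x + 2 * Real.pi) / 2 = x / 2 + Real.pi by ring, Real.sin_add_pi, mul_neg, Real.log_neg_eq_log]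

lemma integral_log_two_mul_sin_half_sub_mul_cos {l : ℕ} (hl : l ≠ 0) (θ : ℝ) :
    ∫ φ in (-Real.pi)..Real.pi, Real.log (2 * Real.sin ((θ - φ) / 2)) * Real.cos (l * φ) =
      -(Real.pi / l) * Real.cos (l * θ) := by
  have h := intervalIntegral.integral_comp_sub_left (a := -Real.pi) (b := Real.pi)
    (fun x => Real.log (2 * Real.sin (x / 2)) * Real.cos (l * (θ - x))) θ
  simp only [sub_sub_cancel] at h
  rw [h]
  have hper : Function.Periodic
      (fun x => Real.log (2 * Real.sin (x / 2)) * Real.cos (l * (θ - x))) (2 * Real.pi) := by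
    intro x
    have := periodic_log_two_mul_sin_half x
    simp only at this ⊢
    rw [this, show l * (θ - (x + 2 * Real.pi)) = l * (θ - x) - l * (2 * Real.pi) by ring,
      Real.cos_sub_nat_mul_two_pi]
  have h2 := hper.intervalIntegral_add_eq (θ - Real.pi) 0
  rw [show θ - Real.pi + 2 * Real.pi = θ - -Real.pi by ring, zero_add] at h2
  rw [h2]
  have h3 : ∀ x : ℝ, Real.log (2 * Real.sin (x / 2)) * Real.cos (l * (θ - x)) =
      Real.cos (l * θ) * (Real.log (2 * Real.sin (x / 2)) * Real.cos (l * x)) +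
      Real.sin (l * θ) * (Real.log (2 * Real.sin (x / 2)) * Real.sin (l * x)) := by
    intro x
    rw [mul_sub, Real.cos_sub]
    ring
  simp only [h3]
  rw [intervalIntegral.integral_add, intervalIntegral.integral_const_mul,
    intervalIntegral.integral_const_mul, integral_log_two_mul_sin_half_mul_cos hl,
    integral_log_two_mul_sin_half_mul_sin]
  · ring
  · exact ((intervalIntegrable_log_two_mul_sin_half _ _).mul_continuousOn
      (by fun_prop : Continuous _).continuousOn).const_mul _
  · exact ((intervalIntegrable_log_two_mul_sin_half _ _).mul_continuousOn
      (by fun_prop : Continuous _).continuousOn).const_mul _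

/-! ### Cosines as eigenfunctions of the kernel of `[-1, 1]` -/

lemma integral_cos_nat_mul_zero_pi {k : ℕ} (hk : k ≠ 0) :
    ∫ θ in (0 : ℝ)..Real.pi, Real.cos (k * θ) = 0 := by
  rw [intervalIntegral.integral_comp_mul_left _ (Nat.cast_ne_zero.2 hk), integral_cos]
  simp [Real.sin_nat_mul_pi]

lemma integral_cos_mul_cos {k l : ℕ} (hk : k ≠ 0) :
    ∫ θ in (0 : ℝ)..Real.pi, Real.cos (k * θ) * Real.cos (l * θ) =
      if k = l then Real.pi / 2 else 0 := by
  have h := Polynomial.Chebyshev.integral_eval_T_real_mul_eval_T_real_measureT k l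
  rw [Polynomial.Chebyshev.integral_measureT_eq_integral_cos] at h
  simp only [Polynomial.Chebyshev.T_real_cos, Int.cast_natCast] at h
  rw [h, Polynomial.Chebyshev.integral_eval_T_real_measureT_of_ne_zero (by omega)]
  split_ifs with hkl
  · have := Polynomial.Chebyshev.integral_eval_T_real_measureT_zero
    rw [hkl, sub_self, this, zero_add]
  · rw [Polynomial.Chebyshev.integral_eval_T_real_measureT_of_ne_zero (by omega)]
    simp

/-- `cos (l φ)` is an eigenfunction of the logarithmic kernel of `[-1, 1]`. -/
lemma integral_log_cos_sub_cos_mul_cos {l : ℕ} (hl : l ≠ 0) {θ : ℝ} (hθ : θ ∈ Ioo 0 Real.pi) :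
    ∫ φ in (0 : ℝ)..Real.pi, Real.log (Real.cos θ - Real.cos φ) * Real.cos (l * φ) =
      -(Real.pi / l) * Real.cos (l * θ) := by
  have hint : ∀ a b : ℝ, IntervalIntegrable
      (fun φ => Real.log (2 * Real.sin ((θ - φ) / 2)) * Real.cos (l * φ)) volume a b := by
    intro a b
    have := (intervalIntegrable_log_two_mul_sin_half (θ - a) (θ - b)).comp_sub_left θ
    simp only [sub_sub_cancel] at this
    exact this.mul_continuousOn (by fun_prop : Continuous _).continuousOn
  have hint' : IntervalIntegrable
      (fun φ => Real.log (2 * Real.sin ((θ + φ) / 2)) * Real.cos (l * φ)) volume 0 Real.pi := by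
    have := (intervalIntegrable_log_two_mul_sin_half (θ + 0) (θ + Real.pi)).comp_add_left θ
    simp only [add_sub_cancel_left] at this
    exact this.mul_continuousOn (by fun_prop : Continuous _).continuousOn
  have hrefl : ∫ φ in (0 : ℝ)..Real.pi, Real.log (2 * Real.sin ((θ + φ) / 2)) * Real.cos (l * φ) =
      ∫ φ in (-Real.pi)..0, Real.log (2 * Real.sin ((θ - φ) / 2)) * Real.cos (l * φ) := by
    have := intervalIntegral.integral_comp_neg (a := 0) (b := Real.pi)
      (fun φ => Real.log (2 * Real.sin ((θ - φ) / 2)) * Real.cos (l * φ))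
    simp only [sub_neg_eq_add, mul_neg, Real.cos_neg, neg_zero] at this
    exact this
  -- `|cos θ - cos φ| = 2 |sin ((θ + φ) / 2)| |sin ((θ - φ) / 2)|`; pairing each sine with a factor
  -- `2` costs `log 2`. The two halves then fold into one integral over `[-π, π]`.
  have hsplit : ∫ φ in (0 : ℝ)..Real.pi, Real.log (Real.cos θ - Real.cos φ) * Real.cos (l * φ) =
      ∫ φ in (0 : ℝ)..Real.pi, ((Real.log (2 * Real.sin ((θ + φ) / 2)) * Real.cos (l * φ) +
        Real.log (2 * Real.sin ((θ - φ) / 2)) * Real.cos (l * φ)) -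
          Real.log 2 * Real.cos (l * φ)) := by
    refine intervalIntegral.integral_congr_ae ?_
    filter_upwards [compl_mem_ae_iff.2 (measure_singleton θ)] with φ hφθ hφ
    rw [uIoc_of_le Real.pi_pos.le] at hφ
    have h1 : Real.sin ((θ + φ) / 2) ≠ 0 := (Real.sin_pos_of_pos_of_lt_pi
      (by linarith [hφ.1, hθ.1]) (by linarith [hφ.2, hθ.2])).ne'
    have h2 : Real.sin ((θ - φ) / 2) ≠ 0 := by
      rw [Ne, Real.sin_eq_zero_iff_of_lt_of_lt (by linarith [hφ.2, hθ.1, hθ.2])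
        (by linarith [hφ.1, hθ.1, hθ.2])]
      intro h
      exact hφθ (by simp; linarith)
    rw [Real.cos_sub_cos, neg_mul, neg_mul, Real.log_neg_eq_log,
      Real.log_mul (by positivity) h2, Real.log_mul two_ne_zero h1, Real.log_mul two_ne_zero h2]
    ring
  rw [hsplit, intervalIntegral.integral_sub (hint'.add (hint _ _))
    ((by fun_prop : Continuous _).intervalIntegrable _ _), intervalIntegral.integral_add hint' (hint _ _),
    hrefl, intervalIntegral.integral_add_adjacent_intervals (hint _ _) (hint _ _),
    integral_log_two_mul_sin_half_sub_mul_cos hl, intervalIntegral.integral_const_mul,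
    integral_cos_nat_mul_zero_pi hl]
  ring

/-! ### Integrability of logarithmic kernels -/

/-- On the square this is the convolution integrand of the indicator of `(a, b]` with `log` cut off
to the range of differences. -/
lemma integrable_log_sub (a b : ℝ) :
    Integrable (fun p : ℝ × ℝ => Real.log (p.1 - p.2))
      ((volume.restrict (Ioc a b)).prod (volume.restrict (Ioc a b))) := by
  have hlog : Integrable ((Ioc (a - b) (b - a)).indicator Real.log) := by
    rw [integrable_indicator_iff measurableSet_Ioc]
    exact (intervalIntegral.intervalIntegrable_log' (a := a - b) (b := b - a)).1
  have hone : Integrable ((Ioc a b).indicator (fun _ => (1 : ℝ))) := by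
    rw [integrable_indicator_iff measurableSet_Ioc]
    exact integrableOn_const (by simp)
  have h := (hone.convolution_integrand (ContinuousLinearMap.mul ℝ ℝ) hlog).restrict
    (s := Ioc a b ×ˢ Ioc a b)
  rw [← Measure.prod_restrict] at h
  refine h.congr ?_
  rw [Measure.prod_restrict]
  filter_upwards [ae_restrict_mem (measurableSet_Ioc.prod measurableSet_Ioc)] with p hp
  have h1 : p.1 - p.2 ∈ Ioc (a - b) (b - a) :=
    ⟨by linarith [hp.1.1, hp.2.2], by linarith [hp.1.2, hp.2.1]⟩
  simp [indicator_of_mem h1, indicator_of_mem hp.2]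

lemma ae_fst_ne_snd (μ ν : Measure ℝ) [SFinite μ] [SFinite ν] [NullSingletonClass ν] :
    ∀ᵐ p ∂(μ.prod ν), p.1 ≠ p.2 := by
  have hmeas : MeasurableSet {p : ℝ × ℝ | p.1 ≠ p.2} :=
    (isClosed_eq continuous_fst continuous_snd).measurableSet.compl
  rw [Measure.ae_prod_iff_ae_ae hmeas]
  refine Eventually.of_forall fun x => ?_
  filter_upwards [compl_mem_ae_iff.2 (measure_singleton x)] with y hy
  exact fun h => hy (by simpa using h.symm)

/-- A kernel comparable from below to a power of the distance has integrable logarithm. -/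
lemma integrable_log_of_pow_le {a b c C : ℝ} {n : ℕ} (hc : 0 < c) {F : ℝ × ℝ → ℝ}
    (hF : Measurable F)
    (hlow : ∀ s ∈ Ioc a b, ∀ t ∈ Ioc a b, c * |s - t| ^ n ≤ F (s, t))
    (hup : ∀ s ∈ Ioc a b, ∀ t ∈ Ioc a b, F (s, t) ≤ C) :
    Integrable (fun p => Real.log (F p))
      ((volume.restrict (Ioc a b)).prod (volume.restrict (Ioc a b))) := by
  refine Integrable.mono' (g := fun p : ℝ × ℝ => |Real.log c| + n * |Real.log (p.1 - p.2)| +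
    |Real.log C|) ?_ (Real.measurable_log.comp hF).aestronglyMeasurable ?_
  · exact ((integrable_const _).add ((integrable_log_sub a b).abs.const_mul _)).add
      (integrable_const _)
  · have hne := ae_fst_ne_snd (volume.restrict (Ioc a b)) (volume.restrict (Ioc a b))
    rw [Measure.prod_restrict] at hne ⊢
    filter_upwards [ae_restrict_mem (measurableSet_Ioc.prod measurableSet_Ioc), hne] with p hp hpne
    have habs : 0 < |p.1 - p.2| := abs_pos.2 (sub_ne_zero.2 hpne)
    have hlo := hlow p.1 hp.1 p.2 hp.2
    have hhi := hup p.1 hp.1 p.2 hp.2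
    have hpos : 0 < c * |p.1 - p.2| ^ n := by positivity
    have h1 := Real.log_le_log hpos hlo
    have h2 := Real.log_le_log (hpos.trans_le hlo) hhi
    rw [Real.log_mul hc.ne' (by positivity), Real.log_pow, Real.log_abs] at h1
    have h3 : (n : ℝ) * Real.log (p.1 - p.2) ≥ -(n * |Real.log (p.1 - p.2)|) := by
      have := mul_le_mul_of_nonneg_left (neg_abs_le (Real.log (p.1 - p.2))) (Nat.cast_nonneg (α := ℝ) n)
      linarith
    have h4 : 0 ≤ (n : ℝ) * |Real.log (p.1 - p.2)| := by positivity
    simp only [Prod.mk.eta] at h1 h2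
    rw [Real.norm_eq_abs, abs_le]
    constructor
    · linarith [neg_abs_le (Real.log c), abs_nonneg (Real.log C)]
    · linarith [le_abs_self (Real.log C), abs_nonneg (Real.log c)]

lemma abs_sin_ge_of_abs_le {x : ℝ} (hx : |x| ≤ Real.pi / 2) :
    2 / Real.pi * |x| ≤ |Real.sin x| := by
  have h := Real.mul_le_sin (abs_nonneg x) hx
  refine h.trans ?_
  rcases abs_cases x with ⟨h, _⟩ | ⟨h, _⟩ <;> rw [h]
  · exact le_abs_self _
  · rw [Real.sin_neg]; exact neg_le_abs _

/-- Jordan's inequality bounds both sines in the product formula by `|θ - φ|`. The power is `2`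
because the cosine is stationary at `0` and `π`. -/
lemma le_abs_cos_sub_cos {θ φ : ℝ} (hθ : θ ∈ Ioc 0 Real.pi) (hφ : φ ∈ Ioc 0 Real.pi) :
    2 / Real.pi ^ 2 * |θ - φ| ^ 2 ≤ |Real.cos θ - Real.cos φ| := by
  have hπ := Real.pi_pos
  have h1 : 2 / Real.pi * |(θ - φ) / 2| ≤ |Real.sin ((θ - φ) / 2)| :=
    abs_sin_ge_of_abs_le (by rw [abs_le]; constructor <;> linarith [hθ.1, hθ.2, hφ.1, hφ.2])
  have h2 : 2 / Real.pi * |(θ - φ) / 2| ≤ |Real.sin ((θ + φ) / 2)| := by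
    have hle : |(θ - φ) / 2| ≤ (θ + φ) / 2 := by
      rw [abs_le]; constructor <;> linarith [hθ.1, hφ.1]
    have hle' : |(θ - φ) / 2| ≤ Real.pi - (θ + φ) / 2 := by
      rw [abs_le]; constructor <;> linarith [hθ.2, hφ.2]
    refine le_trans ?_ (le_abs_self _)
    rcases le_total ((θ + φ) / 2) (Real.pi / 2) with h | h
    · refine (mul_le_mul_of_nonneg_left hle (by positivity)).trans
        (Real.mul_le_sin (by linarith [hθ.1, hφ.1]) h)
    · rw [← Real.sin_pi_sub]
      exact (mul_le_mul_of_nonneg_left hle' (by positivity)).trans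
        (Real.mul_le_sin (by linarith [hθ.2, hφ.2]) (by linarith))
  rw [Real.cos_sub_cos, abs_mul, abs_mul]
  calc 2 / Real.pi ^ 2 * |θ - φ| ^ 2
      = 2 * (2 / Real.pi * |(θ - φ) / 2|) * (2 / Real.pi * |(θ - φ) / 2|) := by
        rw [abs_div, abs_two]; field_simp
    _ ≤ |(-2 : ℝ)| * |Real.sin ((θ + φ) / 2)| * |Real.sin ((θ - φ) / 2)| := by
        rw [abs_neg, abs_two]
        gcongr

lemma integrable_log_abs_cos_sub_cos :
    Integrable (fun p : ℝ × ℝ => Real.log |Real.cos p.1 - Real.cos p.2|)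
      ((volume.restrict (Ioc 0 Real.pi)).prod (volume.restrict (Ioc 0 Real.pi))) := by
  refine integrable_log_of_pow_le (c := 2 / Real.pi ^ 2) (C := 2) (n := 2) (by positivity)
    (F := fun p => |Real.cos p.1 - Real.cos p.2|) (by fun_prop)
    (fun s hs t ht => le_abs_cos_sub_cos hs ht) fun s _ t _ => ?_
  rw [abs_le]
  constructor <;> linarith [Real.cos_le_one s, Real.cos_le_one t, Real.neg_one_le_cos s,
    Real.neg_one_le_cos t]

lemma integrable_mul_cos_mul_cos {g : ℝ × ℝ → ℝ} {m : Measure (ℝ × ℝ)}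
    (hg : Integrable g m) (k l : ℕ) :
    Integrable (fun p : ℝ × ℝ => g p * (Real.cos (k * p.1) * Real.cos (l * p.2))) m := by
  refine hg.mul_bdd (c := 1) (by fun_prop) (Eventually.of_forall fun p => ?_)
  rw [norm_mul]
  exact mul_le_one₀ (Real.abs_cos_le_one _) (norm_nonneg _) (Real.abs_cos_le_one _)

/-- The Chebyshev coefficients of the logarithmic kernel of `[-1, 1]`. -/
lemma integral_log_abs_cos_sub_cos_mul_cos_mul_cos {k l : ℕ} (hk : k ≠ 0) (hl : l ≠ 0) :
    ∫ p : ℝ × ℝ, Real.log |Real.cos p.1 - Real.cos p.2| *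
        (Real.cos (k * p.1) * Real.cos (l * p.2))
      ∂((volume.restrict (Ioc 0 Real.pi)).prod (volume.restrict (Ioc 0 Real.pi))) =
      if k = l then -(Real.pi ^ 2 / (2 * k)) else 0 := by
  rw [integral_prod _ (integrable_mul_cos_mul_cos integrable_log_abs_cos_sub_cos k l)]
  have hinner : ∫ θ in Ioc (0 : ℝ) Real.pi, ∫ φ in Ioc (0 : ℝ) Real.pi,
      Real.log |Real.cos θ - Real.cos φ| * (Real.cos (k * θ) * Real.cos (l * φ)) =
      ∫ θ in Ioc (0 : ℝ) Real.pi,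
        -(Real.pi / l) * (Real.cos (k * θ) * Real.cos (l * θ)) := by
    -- The eigenfunction identity is available for `θ` in the open interval only.
    rw [integral_Ioc_eq_integral_Ioo, integral_Ioc_eq_integral_Ioo (x := 0) (y := Real.pi)]
    refine setIntegral_congr_fun measurableSet_Ioo fun θ hθ => ?_
    have := integral_log_cos_sub_cos_mul_cos hl hθ
    rw [intervalIntegral.integral_of_le Real.pi_pos.le] at this
    simp only [Real.log_abs]
    have h2 : ∀ φ : ℝ, Real.log (Real.cos θ - Real.cos φ) * (Real.cos (k * θ) * Real.cos (l * φ)) =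
        Real.cos (k * θ) * (Real.log (Real.cos θ - Real.cos φ) * Real.cos (l * φ)) :=
      fun φ => by ring
    simp only [h2]
    rw [integral_const_mul, this]
    ring
  rw [hinner, integral_const_mul, ← intervalIntegral.integral_of_le Real.pi_pos.le,
    integral_cos_mul_cos hk]
  split_ifs with h
  · subst h
    have : (k : ℝ) ≠ 0 := Nat.cast_ne_zero.2 hk
    field_simp
  · simp

/-! ### Finite energy of the equilibrium measure -/

/-- An injective regular `C¹` parametrization of an arc is bi-Lipschitz from below. -/
lemma exists_pos_mul_abs_sub_le_norm_sub {w : ℝ → ℂ} {a b : ℝ} (hab : a < b)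
    (hw : ContDiffOn ℝ 1 w (Icc a b)) (hw' : ∀ t ∈ Icc a b, derivWithin w (Icc a b) t ≠ 0)
    (hinj : InjOn w (Icc a b)) :
    ∃ c > 0, ∀ s ∈ Icc a b, ∀ t ∈ Icc a b, c * |s - t| ≤ ‖w s - w t‖ := by
  have hcont : ContinuousOn (derivWithin w (Icc a b)) (Icc a b) :=
    hw.continuousOn_derivWithin (uniqueDiffOn_Icc hab) le_rfl
  let w1 : ℝ → ℂ := fun x => derivWithin w (Icc a b) (projIcc a b hab.le x)
  have hw1 : Continuous w1 :=
    hcont.comp_continuous (by fun_prop) fun x => (projIcc a b hab.le x).2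
  have hw1eq : ∀ x ∈ Icc a b, w1 x = derivWithin w (Icc a b) x := fun x hx => by
    simp only [w1, projIcc_of_mem hab.le hx]
  -- The difference quotient as a mean of the derivative: continuous across the diagonal, where it
  -- equals `w'`. Injectivity off the diagonal and regularity on it make it nonzero, so compactness
  -- gives the constant.
  let Q : ℝ × ℝ → ℂ := fun p => ∫ u in (0 : ℝ)..1, w1 (p.2 + (p.1 - p.2) * u)
  have hQ : Continuous Q := by
    refine intervalIntegral.continuous_parametric_intervalIntegral_of_continuous'
      (f := fun (p : ℝ × ℝ) u => w1 (p.2 + (p.1 - p.2) * u)) ?_ 0 1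
    simp only [Function.uncurry_def]
    fun_prop
  have hQw : ∀ s ∈ Icc a b, ∀ t ∈ Icc a b, w s - w t = (s - t) • Q (s, t) := by
    intro s hs t ht
    simp only [Q]
    rw [intervalIntegral.smul_integral_comp_add_mul]
    simp only [mul_zero, add_zero, mul_one, add_sub_cancel]
    have hsub : uIcc t s ⊆ Icc a b := OrdConnected.uIcc_subset inferInstance ht hs
    refine (intervalIntegral.integral_eq_sub_of_hasDeriv_right (hw.continuousOn.mono hsub) ?_
      (hw1.intervalIntegrable _ _)).symm
    intro x hx
    have hx' : x ∈ Ioo a b :=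
      ⟨(le_min ht.1 hs.1).trans_lt hx.1, hx.2.trans_le (max_le ht.2 hs.2)⟩
    rw [hw1eq x (Ioo_subset_Icc_self hx')]
    exact (((hw.differentiableOn one_ne_zero) x
      (Ioo_subset_Icc_self hx')).hasDerivWithinAt.hasDerivAt
        (Icc_mem_nhds hx'.1 hx'.2)).hasDerivWithinAt
  have hQne : ∀ p ∈ Icc a b ×ˢ Icc a b, Q p ≠ 0 := by
    rintro ⟨s, t⟩ ⟨hs, ht⟩ h0
    simp only at hs ht
    by_cases hst : s = t
    · subst hst
      simp only [Q, sub_self, zero_mul, add_zero, intervalIntegral.integral_const, sub_zero,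
        one_smul] at h0
      rw [hw1eq s hs] at h0
      exact hw' s hs h0
    · have := hQw s hs t ht
      rw [h0, smul_zero] at this
      exact hst (hinj hs ht (sub_eq_zero.1 this))
  obtain ⟨p, hp, hmin⟩ := (isCompact_Icc.prod isCompact_Icc).exists_isMinOn
    (⟨(a, a), ⟨left_mem_Icc.2 hab.le, left_mem_Icc.2 hab.le⟩⟩ : (Icc a b ×ˢ Icc a b).Nonempty)
    hQ.norm.continuousOn
  refine ⟨‖Q p‖, norm_pos_iff.2 (hQne p hp), fun s hs t ht => ?_⟩
  rw [hQw s hs t ht, norm_smul, Real.norm_eq_abs, mul_comm]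
  exact mul_le_mul_of_nonneg_left (hmin (⟨hs, ht⟩ : (s, t) ∈ Icc a b ×ˢ Icc a b)) (abs_nonneg _)

lemma measurable_logKernel : Measurable fun p : ℂ × ℂ => logKernel p.1 p.2 := by
  unfold logKernel
  exact (ENNReal.measurable_log.comp measurable_edist).neg

lemma toENNReal_logKernel {z w : ℂ} (h : z ≠ w) :
    (logKernel z w).toENNReal = ENNReal.ofReal (-Real.log ‖z - w‖) := by
  rw [logKernel, edist_dist, dist_eq_norm,
    ENNReal.log_ofReal_of_pos (norm_pos_iff.2 (sub_ne_zero.2 h)), ← EReal.coe_neg,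
    EReal.real_coe_toENNReal]

lemma lintegral_lintegral_map {Ω : Type*} [MeasurableSpace Ω] {m : Measure Ω} [SFinite m]
    {Z : Ω → ℂ} (hZ : Measurable Z) {K : ℂ × ℂ → ENNReal} (hK : Measurable K) :
    ∫⁻ z, ∫⁻ w, K (z, w) ∂(m.map Z) ∂(m.map Z) =
      ∫⁻ p : Ω × Ω, K (Z p.1, Z p.2) ∂(m.prod m) := by
  rw [lintegral_map (Measurable.lintegral_prod_right' hK) hZ,
    lintegral_prod _ (by fun_prop : Measurable fun p : Ω × Ω => K (Z p.1, Z p.2)).aemeasurable]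
  exact lintegral_congr fun x => lintegral_map (by fun_prop) hZ

/-- A regular Jordan arc carries a probability measure of finite logarithmic energy. -/
lemma exists_logEnergy_lt_top {α : ℝ} {p q : ℂ} {γ : Set ℂ}
    (hγ : IsHolderJordanArc 3 α p q γ) :
    ∃ μ : Measure ℂ, IsProbabilityOn γ μ ∧ logEnergy μ < ⊤ := by
  obtain ⟨w, hw, -, hw', hinj, -, -, himg⟩ := hγ
  have h11 : (-1 : ℝ) < 1 := by norm_num
  obtain ⟨c, hc, hlow⟩ := exists_pos_mul_abs_sub_le_norm_sub h11
    (hw.of_le (by norm_num)) hw' hinj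
  have haff : ∀ u ∈ Ioc (0 : ℝ) 1, 2 * u - 1 ∈ Icc (-1 : ℝ) 1 := fun u hu =>
    ⟨by linarith [hu.1], by linarith [hu.2]⟩
  -- Rescaled so that Lebesgue measure on `(0, 1]` is a probability measure; the projection makes
  -- `W` continuous on the whole line.
  let W : ℝ → ℂ := fun u => w (projIcc (-1) 1 h11.le (2 * u - 1))
  have hW : Continuous W :=
    hw.continuousOn.comp_continuous (by fun_prop) fun x => (projIcc (-1) 1 h11.le _).2
  have hWγ : ∀ u, W u ∈ γ := fun u => by
    rw [← himg]
    exact mem_image_of_mem w (projIcc (-1) 1 h11.le _).2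
  have hWeq : ∀ u ∈ Ioc (0 : ℝ) 1, W u = w (2 * u - 1) := fun u hu => by
    simp only [W, projIcc_of_mem h11.le (haff u hu)]
  obtain ⟨R, hR⟩ := (isCompact_Icc.image_of_continuousOn hw.continuousOn).isBounded.exists_norm_le
  rw [himg] at hR
  have hWlow : ∀ s ∈ Ioc (0 : ℝ) 1, ∀ t ∈ Ioc (0 : ℝ) 1, 2 * c * |s - t| ^ 1 ≤ ‖W s - W t‖ := by
    intro s hs t ht
    have := hlow _ (haff s hs) _ (haff t ht)
    rw [hWeq s hs, hWeq t ht]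
    refine le_trans (le_of_eq ?_) this
    rw [show 2 * s - 1 - (2 * t - 1) = 2 * (s - t) by ring, abs_mul, abs_two]
    ring
  set m : Measure ℝ := volume.restrict (Ioc 0 1) with hm
  have hmp : IsProbabilityMeasure m := ⟨by simp [hm]⟩
  have hlogint : Integrable (fun p : ℝ × ℝ => Real.log ‖W p.1 - W p.2‖) (m.prod m) :=
    integrable_log_of_pow_le (c := 2 * c) (C := R + R) (n := 1) (by positivity)
      (F := fun p : ℝ × ℝ => ‖W p.1 - W p.2‖) (by fun_prop) hWlow
      fun s _ t _ => (norm_sub_le _ _).trans (add_le_add (hR _ (hWγ s)) (hR _ (hWγ t)))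
  refine ⟨m.map W, ⟨Measure.isProbabilityMeasure_map hW.aemeasurable, ?_⟩, ?_⟩
  · have hγm : MeasurableSet γ := by
      rw [← himg]
      exact (isCompact_Icc.image_of_continuousOn hw.continuousOn).measurableSet
    rw [Measure.map_apply hW.measurable hγm.compl]
    have : W ⁻¹' γᶜ = ∅ := by
      ext u
      simp [hWγ u]
    simp [this]
  · have hP : ∫⁻ z, ∫⁻ w, (logKernel z w).toENNReal ∂(m.map W) ∂(m.map W) < ⊤ := by
      rw [lintegral_lintegral_map hW.measurable (K := fun p => (logKernel p.1 p.2).toENNReal)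
        measurable_logKernel.ereal_toENNReal]
      refine lt_of_le_of_lt (lintegral_mono_ae ?_) hlogint.2
      have hne := ae_fst_ne_snd m m
      rw [hm, Measure.prod_restrict] at hne ⊢
      filter_upwards [ae_restrict_mem (measurableSet_Ioc.prod measurableSet_Ioc), hne] with p hp hpne
      have hW12 : W p.1 ≠ W p.2 := by
        intro h
        have := hWlow p.1 hp.1 p.2 hp.2
        rw [h, sub_self, norm_zero, pow_one] at this
        have : 0 < 2 * c * |p.1 - p.2| := by
          have := abs_pos.2 (sub_ne_zero.2 hpne)
          positivity
        linarith
      rw [toENNReal_logKernel hW12, ← ofReal_norm]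
      exact ENNReal.ofReal_le_ofReal (neg_le_abs _)
    rw [logEnergy, sub_eq_add_neg]
    refine EReal.add_lt_top ?_ ?_
    · simpa using hP.ne
    · refine ne_top_of_le_ne_top EReal.zero_ne_top ?_
      rw [EReal.neg_le, neg_zero]
      exact EReal.coe_ennreal_nonneg _

/-- The equilibrium measure of a regular Jordan arc has finite logarithmic energy. -/
lemma lintegral_logKernel_lt_top {α : ℝ} {p q : ℂ} {γ : Set ℂ}
    (hγ : IsHolderJordanArc 3 α p q γ) {ν : Measure ℂ} (hν : IsEquilibriumMeasure γ ν) :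
    ∫⁻ z, ∫⁻ w, (logKernel z w).toENNReal ∂ν ∂ν < ⊤ := by
  obtain ⟨μ, hμ, hμtop⟩ := exists_logEnergy_lt_top hγ
  obtain ⟨w, hw, -, -, -, -, -, himg⟩ := hγ
  obtain ⟨⟨hprob, hνγ⟩, hmin⟩ := hν
  have hlt := (hmin μ hμ).trans_lt hμtop
  obtain ⟨R, hR⟩ := (isCompact_Icc.image_of_continuousOn hw.continuousOn).isBounded.exists_norm_le
  rw [himg] at hR
  have hae : ∀ᵐ z ∂ν, z ∈ γ := by rwa [ae_iff]
  -- In `EReal`, `⊤ - ⊤ = ⊥`, so energy below `⊤` bounds the positive part only once the negative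
  -- part is finite; boundedness of `γ` ensures this.
  have hN : ∫⁻ z, ∫⁻ w, (-logKernel z w).toENNReal ∂ν ∂ν ≠ ⊤ := by
    refine ne_top_of_le_ne_top (b := (ENNReal.log (ENNReal.ofReal (R + R))).toENNReal) ?_ ?_
    · rw [EReal.toENNReal_ne_top_iff, Ne, ENNReal.log_eq_top_iff]
      exact ENNReal.ofReal_ne_top
    · calc ∫⁻ z, ∫⁻ w, (-logKernel z w).toENNReal ∂ν ∂ν
          ≤ ∫⁻ _, ∫⁻ _, (ENNReal.log (ENNReal.ofReal (R + R))).toENNReal ∂ν ∂ν := by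
            refine lintegral_mono_ae ?_
            filter_upwards [hae] with z hz
            refine lintegral_mono_ae ?_
            filter_upwards [hae] with w hw
            refine EReal.toENNReal_le_toENNReal ?_
            rw [logKernel, neg_neg, edist_dist, dist_eq_norm]
            exact ENNReal.log_le_log (ENNReal.ofReal_le_ofReal
              ((norm_sub_le _ _).trans (add_le_add (hR z hz) (hR w hw))))
        _ = _ := by simp
  rw [lt_top_iff_ne_top]
  intro htop
  rw [logEnergy, htop] at hlt
  rw [← ENNReal.ofReal_toReal hN, EReal.coe_ennreal_ofReal, EReal.coe_ennreal_top,
    EReal.top_sub_coe] at hlt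
  exact lt_irrefl _ hlt

/-! ### The equilibrium measure in the angular parameter -/

lemma integral_one_div_sqrt_one_sub_sq {t : ℝ} (ht : t ∈ Icc (-1 : ℝ) 1) :
    ∫ s in (-1 : ℝ)..t, 1 / Real.sqrt (1 - s ^ 2) = Real.pi - Real.arccos t := by
  have h := intervalIntegral.integral_eq_sub_of_hasDerivAt_of_le (f := fun s => -Real.arccos s)
    (f' := fun s => 1 / Real.sqrt (1 - s ^ 2)) ht.1 Real.continuous_arccos.neg.continuousOn
    (fun s hs => by
      simpa using! (Real.hasDerivAt_arccos hs.1.ne' (hs.2.trans_le ht.2).ne).neg) ?_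
  · rw [h, Real.arccos_neg_one]
    ring
  · have := Polynomial.Chebyshev.intervalIntegrable_sqrt_one_sub_sq_inv
    simp only [Real.sqrt_inv] at this
    simp only [← one_div] at this
    refine this.mono_set ?_
    rw [uIcc_of_le ht.1, uIcc_of_le (by norm_num)]
    exact Icc_subset_Icc_right ht.2

lemma volume_cos_le {t : ℝ} (ht : t ∈ Icc (-1 : ℝ) 1) :
    volume.restrict (Ioc 0 Real.pi) {θ | Real.cos θ ≤ t} =
      ENNReal.ofReal (Real.pi - Real.arccos t) := by
  have hmeas : MeasurableSet {θ | Real.cos θ ≤ t} :=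
    measurableSet_le Real.measurable_cos measurable_const
  have hiff : ∀ θ ∈ Ioc 0 Real.pi, Real.cos θ ≤ t ↔ Real.arccos t ≤ θ := by
    intro θ hθ
    conv_lhs => rw [← Real.cos_arccos ht.1 ht.2]
    exact Real.strictAntiOn_cos.le_iff_ge (Ioc_subset_Icc_self hθ)
      ⟨Real.arccos_nonneg t, Real.arccos_le_pi t⟩
  rw [Measure.restrict_apply hmeas]
  refine le_antisymm ?_ ?_
  · rw [← Real.volume_Icc]
    exact measure_mono fun θ hθ => ⟨(hiff θ hθ.2).1 hθ.1, hθ.2.2⟩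
  · rw [← Real.volume_Ioc]
    refine measure_mono fun θ hθ => ?_
    have hmem : θ ∈ Ioc 0 Real.pi := ⟨(Real.arccos_nonneg t).trans_lt hθ.1, hθ.2⟩
    exact ⟨(hiff θ hmem).2 hθ.1.le, hmem⟩

lemma continuous_comp_cos {z : ℝ → ℂ} (hz : ContinuousOn z (Icc (-1) 1)) :
    Continuous fun θ => z (Real.cos θ) :=
  hz.comp_continuous Real.continuous_cos fun θ => ⟨Real.neg_one_le_cos θ, Real.cos_le_one θ⟩

/-- The equilibrium parametrization composed with the cosine carries Lebesgue measure on
`(0, π]` to `π` times the equilibrium measure. -/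
lemma map_comp_cos_eq {z : ℝ → ℂ} {γ : Set ℂ} {ν : Measure ℂ} (hcont : ContinuousOn z (Icc (-1) 1))
    (hinj : InjOn z (Icc (-1) 1)) (himg : z '' Icc (-1) 1 = γ) [IsFiniteMeasure ν]
    (hνγ : ν γᶜ = 0)
    (hν : ∀ t ∈ Icc (-1 : ℝ) 1, ν (z '' Icc (-1) t) =
      ENNReal.ofReal (1 / Real.pi * ∫ s in (-1 : ℝ)..t, 1 / Real.sqrt (1 - s ^ 2))) :
    (volume.restrict (Ioc 0 Real.pi)).map (fun θ => z (Real.cos θ)) =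
      ENNReal.ofReal Real.pi • ν := by
  let e : Icc (-1 : ℝ) 1 → ℂ := (Icc (-1 : ℝ) 1).domRestrict z
  have he : MeasurableEmbedding e :=
    (continuousOn_iff_continuous_domRestrict.1 hcont).measurableEmbedding
      (injOn_iff_injective.1 hinj)
  let g : ℝ → Icc (-1 : ℝ) 1 := fun θ =>
    ⟨Real.cos θ, Real.neg_one_le_cos θ, Real.cos_le_one θ⟩
  have hg : Measurable g := Real.measurable_cos.subtype_mk
  have hmap : (ν.comap e).map e = ν := by
    rw [he.map_comap, show range e = γ from (range_domRestrict z _).trans himg]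
    exact Measure.restrict_eq_self_of_ae_mem (by rwa [ae_iff])
  have hlaw : (volume.restrict (Ioc 0 Real.pi)).map g = ENNReal.ofReal Real.pi • ν.comap e := by
    -- Pulled back to `[-1, 1]`, both measures are determined by their distribution functions, here
    -- `π - arccos t`.
    refine Measure.ext_of_Iic _ _ fun t => ?_
    have himage : e '' Iic t = z '' Icc (-1) t := by
      ext x
      constructor
      · rintro ⟨s, hs, rfl⟩
        exact ⟨s, ⟨s.2.1, hs⟩, rfl⟩
      · rintro ⟨s, hs, rfl⟩
        exact ⟨⟨s, hs.1, hs.2.trans t.2.2⟩, hs.2, rfl⟩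
    rw [Measure.map_apply hg measurableSet_Iic, Measure.smul_apply, he.comap_apply, himage,
      hν t t.2, integral_one_div_sqrt_one_sub_sq t.2, smul_eq_mul,
      ← ENNReal.ofReal_mul Real.pi_pos.le, ← mul_assoc, mul_one_div_cancel Real.pi_ne_zero,
      one_mul, ← volume_cos_le t.2]
    rfl
  calc (volume.restrict (Ioc 0 Real.pi)).map (fun θ => z (Real.cos θ))
      = ((volume.restrict (Ioc 0 Real.pi)).map g).map e := (Measure.map_map he.measurable hg).symm
    _ = ENNReal.ofReal Real.pi • ν := by rw [hlaw, Measure.map_smul, hmap]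

lemma ae_comp_cos_ne {z : ℝ → ℂ} (hinj : InjOn z (Icc (-1) 1)) :
    ∀ᵐ p ∂((volume.restrict (Ioc 0 Real.pi)).prod (volume.restrict (Ioc 0 Real.pi))),
      z (Real.cos p.1) ≠ z (Real.cos p.2) := by
  have hne := ae_fst_ne_snd (volume.restrict (Ioc 0 Real.pi)) (volume.restrict (Ioc 0 Real.pi))
  rw [Measure.prod_restrict] at hne ⊢
  filter_upwards [ae_restrict_mem (measurableSet_Ioc.prod measurableSet_Ioc), hne] with p hp hpne h
  exact hpne (Real.injOn_cos (Ioc_subset_Icc_self hp.1) (Ioc_subset_Icc_self hp.2)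
    (hinj (Real.cos_mem_Icc _) (Real.cos_mem_Icc _) h))

/-- The logarithmic kernel of the arc is integrable in the equilibrium parametrization. -/
lemma integrable_log_norm_comp_cos_sub {α : ℝ} {p q : ℂ} {γ : Set ℂ}
    (hγ : IsHolderJordanArc 3 α p q γ) {z : ℝ → ℂ}
    (hz : IsEquilibriumParametrization p q γ z) :
    Integrable (fun p : ℝ × ℝ => Real.log ‖z (Real.cos p.1) - z (Real.cos p.2)‖)
      ((volume.restrict (Ioc 0 Real.pi)).prod (volume.restrict (Ioc 0 Real.pi))) := by
  obtain ⟨hcont, hinj, himg, -, -, ν, hν, hνt⟩ := hz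
  have hfin := lintegral_logKernel_lt_top hγ hν
  obtain ⟨⟨hprob, hνγ⟩, -⟩ := hν
  have hmap := map_comp_cos_eq hcont hinj himg hνγ hνt
  have hZ := (continuous_comp_cos hcont).measurable
  set m := volume.restrict (Ioc 0 Real.pi) with hm
  have hP : ∫⁻ p : ℝ × ℝ, (logKernel (z (Real.cos p.1)) (z (Real.cos p.2))).toENNReal
      ∂(m.prod m) < ⊤ := by
    rw [← lintegral_lintegral_map hZ (K := fun p => (logKernel p.1 p.2).toENNReal)
      measurable_logKernel.ereal_toENNReal, hmap]
    simp only [lintegral_smul_measure, smul_eq_mul]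
    rw [lintegral_const_mul' _ _ ENNReal.ofReal_ne_top]
    exact ENNReal.mul_lt_top ENNReal.ofReal_lt_top (ENNReal.mul_lt_top ENNReal.ofReal_lt_top hfin)
  obtain ⟨R, hR⟩ := (isCompact_Icc.image_of_continuousOn hcont).isBounded.exists_norm_le
  have hmeas : Measurable fun p : ℝ × ℝ => ‖z (Real.cos p.1) - z (Real.cos p.2)‖ :=
    ((hZ.comp measurable_fst).sub (hZ.comp measurable_snd)).norm
  refine ⟨(Real.measurable_log.comp hmeas).aestronglyMeasurable, ?_⟩
  -- Where the logarithm is positive, `log r ≤ r ≤ 2R`; elsewhere its absolute value is the positive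
  -- part of the kernel.
  calc ∫⁻ p : ℝ × ℝ, ‖Real.log ‖z (Real.cos p.1) - z (Real.cos p.2)‖‖ₑ ∂(m.prod m)
      ≤ ∫⁻ p : ℝ × ℝ, ((logKernel (z (Real.cos p.1)) (z (Real.cos p.2))).toENNReal +
          ENNReal.ofReal (R + R)) ∂(m.prod m) := by
        refine lintegral_mono_ae ?_
        filter_upwards [ae_comp_cos_ne hinj] with p hp
        rw [toENNReal_logKernel hp, ← ofReal_norm]
        have hle : ‖z (Real.cos p.1) - z (Real.cos p.2)‖ ≤ R + R :=
          (norm_sub_le _ _).trans (add_le_add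
            (hR _ (mem_image_of_mem z (Real.cos_mem_Icc _)))
            (hR _ (mem_image_of_mem z (Real.cos_mem_Icc _))))
        have hlog := Real.log_le_self (norm_nonneg (z (Real.cos p.1) - z (Real.cos p.2)))
        rcases le_total 0 (Real.log ‖z (Real.cos p.1) - z (Real.cos p.2)‖) with h | h
        · rw [Real.norm_eq_abs, abs_of_nonneg h]
          exact (ENNReal.ofReal_le_ofReal (hlog.trans hle)).trans le_add_self
        · rw [Real.norm_eq_abs, abs_of_nonpos h]
          exact le_self_add
    _ < ⊤ := by
        rw [lintegral_add_right _ measurable_const, lintegral_const]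
        exact ENNReal.add_lt_top.2 ⟨hP, ENNReal.mul_lt_top ENNReal.ofReal_lt_top
          (measure_lt_top _ _)⟩

/-! ### The arc-Grunsky matrix as an energy form -/

lemma ae_log_norm_div_eq {z : ℝ → ℂ} (hinj : InjOn z (Icc (-1) 1)) :
    (fun p : ℝ × ℝ => Real.log ‖(z (Real.cos p.1) - z (Real.cos p.2)) /
        ((Real.cos p.1 : ℂ) - (Real.cos p.2 : ℂ))‖) =ᵐ[
      (volume.restrict (Ioc 0 Real.pi)).prod (volume.restrict (Ioc 0 Real.pi))]
    fun p => Real.log ‖z (Real.cos p.1) - z (Real.cos p.2)‖ -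
      Real.log |Real.cos p.1 - Real.cos p.2| := by
  filter_upwards [ae_comp_cos_ne hinj] with p hp
  have hcos : Real.cos p.1 - Real.cos p.2 ≠ 0 := fun h => hp (by rw [sub_eq_zero.1 h])
  rw [← Complex.ofReal_sub, norm_div, Complex.norm_real, Real.norm_eq_abs,
    Real.log_div (norm_ne_zero_iff.2 (sub_ne_zero.2 hp)) (abs_ne_zero.2 hcos)]

section

variable {α : ℝ} {p q : ℂ} {γ : Set ℂ} {z : ℝ → ℂ}

lemma integrable_log_norm_div (hγ : IsHolderJordanArc 3 α p q γ)
    (hz : IsEquilibriumParametrization p q γ z) :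
    Integrable (fun p : ℝ × ℝ => Real.log ‖(z (Real.cos p.1) - z (Real.cos p.2)) /
        ((Real.cos p.1 : ℂ) - (Real.cos p.2 : ℂ))‖)
      ((volume.restrict (Ioc 0 Real.pi)).prod (volume.restrict (Ioc 0 Real.pi))) :=
  ((integrable_log_norm_comp_cos_sub hγ hz).sub integrable_log_abs_cos_sub_cos).congr
    (ae_log_norm_div_eq hz.2.1).symm

lemma arcGrunskyCoeff_eq_integral_prod (hγ : IsHolderJordanArc 3 α p q γ)
    (hz : IsEquilibriumParametrization p q γ z) (k l : ℕ+) :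
    arcGrunskyCoeff z k l = -(2 / Real.pi ^ 2) *
      ∫ p : ℝ × ℝ, Real.log ‖(z (Real.cos p.1) - z (Real.cos p.2)) /
        ((Real.cos p.1 : ℂ) - (Real.cos p.2 : ℂ))‖ *
          (Real.cos ((k : ℕ) * p.1) * Real.cos ((l : ℕ) * p.2))
      ∂((volume.restrict (Ioc 0 Real.pi)).prod (volume.restrict (Ioc 0 Real.pi))) := by
  rw [integral_prod _ (integrable_mul_cos_mul_cos (integrable_log_norm_div hγ hz) k l),
    arcGrunskyCoeff]
  simp only [intervalIntegral.integral_of_le Real.pi_pos.le, mul_assoc]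

lemma arcGrunskyMatrix_symm (hγ : IsHolderJordanArc 3 α p q γ)
    (hz : IsEquilibriumParametrization p q γ z) (k l : ℕ+) :
    arcGrunskyMatrix z k l = arcGrunskyMatrix z l k := by
  rw [arcGrunskyMatrix, arcGrunskyMatrix, mul_comm ((k : ℕ) : ℝ),
    arcGrunskyCoeff_eq_integral_prod hγ hz, arcGrunskyCoeff_eq_integral_prod hγ hz,
    ← integral_prod_swap]
  congr 2
  refine integral_congr_ae (Eventually.of_forall fun p => ?_)
  simp only [Prod.fst_swap, Prod.snd_swap]
  rw [mul_comm (Real.cos _) (Real.cos _), ← neg_sub (z _) (z _),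
    ← neg_sub (Real.cos p.1 : ℂ) (Real.cos p.2 : ℂ), neg_div_neg_eq]

/-- The entries of `I + B` are logarithmic energies of Chebyshev densities on the arc. -/
lemma one_add_arcGrunskyMatrix_eq (hγ : IsHolderJordanArc 3 α p q γ)
    (hz : IsEquilibriumParametrization p q γ z) (k l : ℕ+) :
    (if k = l then 1 else 0) + arcGrunskyMatrix z k l =
      -(2 / Real.pi ^ 2) * (Real.sqrt (k : ℕ) * Real.sqrt (l : ℕ) *
        ∫ p : ℝ × ℝ, Real.log ‖z (Real.cos p.1) - z (Real.cos p.2)‖ *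
          (Real.cos ((k : ℕ) * p.1) * Real.cos ((l : ℕ) * p.2))
        ∂((volume.restrict (Ioc 0 Real.pi)).prod (volume.restrict (Ioc 0 Real.pi)))) := by
  have hsub : ∫ p : ℝ × ℝ, Real.log ‖(z (Real.cos p.1) - z (Real.cos p.2)) /
        ((Real.cos p.1 : ℂ) - (Real.cos p.2 : ℂ))‖ *
          (Real.cos ((k : ℕ) * p.1) * Real.cos ((l : ℕ) * p.2))
      ∂((volume.restrict (Ioc 0 Real.pi)).prod (volume.restrict (Ioc 0 Real.pi))) =
      (∫ p : ℝ × ℝ, Real.log ‖z (Real.cos p.1) - z (Real.cos p.2)‖ *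
          (Real.cos ((k : ℕ) * p.1) * Real.cos ((l : ℕ) * p.2))
        ∂((volume.restrict (Ioc 0 Real.pi)).prod (volume.restrict (Ioc 0 Real.pi)))) -
      ∫ p : ℝ × ℝ, Real.log |Real.cos p.1 - Real.cos p.2| *
          (Real.cos ((k : ℕ) * p.1) * Real.cos ((l : ℕ) * p.2))
        ∂((volume.restrict (Ioc 0 Real.pi)).prod (volume.restrict (Ioc 0 Real.pi))) := by
    rw [← integral_sub
      (integrable_mul_cos_mul_cos (integrable_log_norm_comp_cos_sub hγ hz) k l)
      (integrable_mul_cos_mul_cos integrable_log_abs_cos_sub_cos k l)]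
    refine integral_congr_ae ?_
    filter_upwards [ae_log_norm_div_eq hz.2.1] with p hp
    rw [hp, sub_mul]
  rw [arcGrunskyMatrix, arcGrunskyCoeff_eq_integral_prod hγ hz, hsub,
    integral_log_abs_cos_sub_cos_mul_cos_mul_cos k.ne_zero l.ne_zero,
    Real.sqrt_mul (Nat.cast_nonneg _)]
  simp only [PNat.coe_inj]
  have hπ := Real.pi_ne_zero
  split_ifs with h
  · subst h
    have hk : (0 : ℝ) < (k : ℕ) := Nat.cast_pos.2 k.pos
    rw [Real.mul_self_sqrt hk.le]
    field_simp
    ring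
  · ring

lemma exists_bound_finset_sum_cos (F : Finset ℕ+) (c : ℕ+ → ℝ) :
    ∃ M, ∀ θ : ℝ, |∑ k ∈ F, c k * Real.cos ((k : ℕ) * θ)| ≤ M := by
  refine ⟨∑ k ∈ F, |c k|, fun θ => (Finset.abs_sum_le_sum_abs _ _).trans
    (Finset.sum_le_sum fun k _ => ?_)⟩
  rw [abs_mul]
  exact mul_le_of_le_one_right (abs_nonneg _) (Real.abs_cos_le_one _)

/-- `I + B` is positive semidefinite. -/
lemma quadraticForm_nonneg (hγ : IsHolderJordanArc 3 α p q γ)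
    (hz : IsEquilibriumParametrization p q γ z) (F : Finset ℕ+) (x : ℕ+ → ℝ) :
    0 ≤ ∑ k ∈ F, ∑ l ∈ F, ((if k = l then 1 else 0) + arcGrunskyMatrix z k l) * x k * x l := by
  set m := volume.restrict (Ioc 0 Real.pi) with hm
  -- The weights `√k` reproduce the factor `√(k l)` in `b k l`.
  let f : ℝ → ℝ := fun θ => ∑ k ∈ F, (x k * Real.sqrt (k : ℕ)) * Real.cos ((k : ℕ) * θ)
  obtain ⟨M, hM⟩ := exists_bound_finset_sum_cos F fun k => x k * Real.sqrt (k : ℕ)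
  have hint := integrable_log_norm_comp_cos_sub hγ hz
  have hf0 : ∫ θ, f θ ∂m = 0 := by
    rw [hm, ← intervalIntegral.integral_of_le Real.pi_pos.le]
    simp only [f]
    rw [intervalIntegral.integral_finsetSum
      (fun k _ => (by fun_prop : Continuous _).intervalIntegrable _ _)]
    refine Finset.sum_eq_zero fun k _ => ?_
    rw [intervalIntegral.integral_const_mul, integral_cos_nat_mul_zero_pi k.ne_zero, mul_zero]
  have henergy := integral_mul_mul_log_norm_sub_nonpos (μ := m) (f := f)
    (continuous_comp_cos hz.1).measurable (by fun_prop) hM hf0 (ae_comp_cos_ne hz.2.1) hint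
  have hexp : ∫ p : ℝ × ℝ, f p.1 * f p.2 * Real.log ‖z (Real.cos p.1) - z (Real.cos p.2)‖
      ∂(m.prod m) = ∑ k ∈ F, ∑ l ∈ F, x k * x l * (Real.sqrt (k : ℕ) * Real.sqrt (l : ℕ) *
        ∫ p : ℝ × ℝ, Real.log ‖z (Real.cos p.1) - z (Real.cos p.2)‖ *
          (Real.cos ((k : ℕ) * p.1) * Real.cos ((l : ℕ) * p.2)) ∂(m.prod m)) := by
    have hpt : ∀ p : ℝ × ℝ,
        f p.1 * f p.2 * Real.log ‖z (Real.cos p.1) - z (Real.cos p.2)‖ =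
        ∑ k ∈ F, ∑ l ∈ F, (x k * x l * (Real.sqrt (k : ℕ) * Real.sqrt (l : ℕ))) *
          (Real.log ‖z (Real.cos p.1) - z (Real.cos p.2)‖ *
            (Real.cos ((k : ℕ) * p.1) * Real.cos ((l : ℕ) * p.2))) := by
      intro p
      simp only [f]
      rw [Finset.sum_mul_sum, Finset.sum_mul]
      refine Finset.sum_congr rfl fun k _ => ?_
      rw [Finset.sum_mul]
      exact Finset.sum_congr rfl fun l _ => by ring
    simp only [hpt]
    have hi : ∀ k l : ℕ+, Integrable (fun p : ℝ × ℝ =>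
        (x k * x l * (Real.sqrt (k : ℕ) * Real.sqrt (l : ℕ))) *
          (Real.log ‖z (Real.cos p.1) - z (Real.cos p.2)‖ *
            (Real.cos ((k : ℕ) * p.1) * Real.cos ((l : ℕ) * p.2)))) (m.prod m) :=
      fun k l => (integrable_mul_cos_mul_cos hint k l).const_mul _
    rw [integral_finsetSum _ fun k _ => integrable_finsetSum _ fun l _ => hi k l]
    refine Finset.sum_congr rfl fun k _ => ?_
    rw [integral_finsetSum _ fun l _ => hi k l]
    refine Finset.sum_congr rfl fun l _ => ?_
    rw [integral_const_mul, mul_assoc]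
  have hform : ∑ k ∈ F, ∑ l ∈ F,
      ((if k = l then 1 else 0) + arcGrunskyMatrix z k l) * x k * x l =
      -(2 / Real.pi ^ 2) * ∫ p : ℝ × ℝ, f p.1 * f p.2 *
        Real.log ‖z (Real.cos p.1) - z (Real.cos p.2)‖ ∂(m.prod m) := by
    rw [hexp, Finset.mul_sum]
    refine Finset.sum_congr rfl fun k _ => ?_
    rw [Finset.mul_sum]
    refine Finset.sum_congr rfl fun l _ => ?_
    rw [one_add_arcGrunskyMatrix_eq hγ hz]
    ring
  rw [hform]
  exact mul_nonneg_of_nonpos_of_nonpos (neg_nonpos.2 (by positivity)) henergy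

/-! ### Uniqueness of the expansion coefficients -/

lemma integral_prod_cos_mul_cos (k l i j : ℕ+) :
    ∫ p : ℝ × ℝ, (Real.cos ((i : ℕ) * p.1) * Real.cos ((j : ℕ) * p.2)) *
        (Real.cos ((k : ℕ) * p.1) * Real.cos ((l : ℕ) * p.2))
      ∂((volume.restrict (Ioc 0 Real.pi)).prod (volume.restrict (Ioc 0 Real.pi))) =
      if (i, j) = (k, l) then Real.pi ^ 2 / 4 else 0 := by
  have h : ∀ p : ℝ × ℝ, (Real.cos ((i : ℕ) * p.1) * Real.cos ((j : ℕ) * p.2)) *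
        (Real.cos ((k : ℕ) * p.1) * Real.cos ((l : ℕ) * p.2)) =
      (Real.cos ((i : ℕ) * p.1) * Real.cos ((k : ℕ) * p.1)) *
        (Real.cos ((j : ℕ) * p.2) * Real.cos ((l : ℕ) * p.2)) := fun p => by ring
  simp only [h]
  rw [integral_prod_mul (fun θ => Real.cos ((i : ℕ) * θ) * Real.cos ((k : ℕ) * θ))
      (fun θ => Real.cos ((j : ℕ) * θ) * Real.cos ((l : ℕ) * θ)),
    ← intervalIntegral.integral_of_le Real.pi_pos.le,
    ← intervalIntegral.integral_of_le Real.pi_pos.le, integral_cos_mul_cos i.ne_zero,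
    integral_cos_mul_cos j.ne_zero]
  simp only [PNat.coe_inj, Prod.mk.injEq]
  by_cases hik : i = k
  · by_cases hjl : j = l
    · simp only [hik, hjl, and_self, if_true]
      ring
    · simp [hjl]
  · simp [hik]

lemma integral_prod_cos_mul_cos_eq_zero (k l : ℕ+) :
    ∫ p : ℝ × ℝ, Real.cos ((k : ℕ) * p.1) * Real.cos ((l : ℕ) * p.2)
      ∂((volume.restrict (Ioc 0 Real.pi)).prod (volume.restrict (Ioc 0 Real.pi))) = 0 := by
  rw [integral_prod_mul (fun θ => Real.cos ((k : ℕ) * θ)) (fun θ => Real.cos ((l : ℕ) * θ)),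
    ← intervalIntegral.integral_of_le Real.pi_pos.le, integral_cos_nat_mul_zero_pi k.ne_zero,
    zero_mul]

/-- The coefficients of an arc-Grunsky expansion are the Chebyshev coefficients. -/
lemma eq_arcGrunskyCoeff_of_isArcGrunskyExpansion (hγ : IsHolderJordanArc 3 α p q γ)
    (hz : IsEquilibriumParametrization p q γ z) {a : ℕ+ → ℕ+ → ℝ}
    (ha : IsArcGrunskyExpansion γ z a) (k l : ℕ+) : a k l = arcGrunskyCoeff z k l := by
  obtain ⟨S, hS, hSlog⟩ := ha
  set m := volume.restrict (Ioc 0 Real.pi) with hm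
  set Λ : ℝ × ℝ → ℝ := fun p => Real.log ‖(z (Real.cos p.1) - z (Real.cos p.2)) /
    ((Real.cos p.1 : ℂ) - (Real.cos p.2 : ℂ))‖ with hΛ
  have hΛint : Integrable Λ (m.prod m) := integrable_log_norm_div hγ hz
  have hne : ∀ᵐ p ∂(m.prod m), Real.cos p.1 ≠ Real.cos p.2 := by
    filter_upwards [ae_comp_cos_ne hz.2.1] with p hp h
    exact hp (by rw [h])
  -- Integrability of `S` is read off from the known integrability of `Λ`.
  have hSae : (fun p : ℝ × ℝ => (Real.log (2 * logCapacity γ) - Λ p) / 2) =ᵐ[m.prod m]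
      fun p => S (Real.cos p.1, Real.cos p.2) := by
    filter_upwards [hne] with p hp
    have := hSlog _ (Real.cos_mem_Icc p.1) _ (Real.cos_mem_Icc p.2) hp
    simp only [hΛ]
    linarith
  have hSint : Integrable (fun p : ℝ × ℝ => S (Real.cos p.1, Real.cos p.2)) (m.prod m) :=
    (((integrable_const _).sub hΛint).div_const 2).congr hSae
  have hJ : ∫ p : ℝ × ℝ, S (Real.cos p.1, Real.cos p.2) *
      (Real.cos ((k : ℕ) * p.1) * Real.cos ((l : ℕ) * p.2)) ∂(m.prod m) =
      Real.pi ^ 2 / 4 * arcGrunskyCoeff z k l := by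
    have h1 : ∫ p : ℝ × ℝ, S (Real.cos p.1, Real.cos p.2) *
        (Real.cos ((k : ℕ) * p.1) * Real.cos ((l : ℕ) * p.2)) ∂(m.prod m) =
        ∫ p : ℝ × ℝ, (Real.log (2 * logCapacity γ) / 2 *
            (Real.cos ((k : ℕ) * p.1) * Real.cos ((l : ℕ) * p.2)) -
          1 / 2 * (Λ p * (Real.cos ((k : ℕ) * p.1) * Real.cos ((l : ℕ) * p.2)))) ∂(m.prod m) := by
      refine integral_congr_ae ?_
      filter_upwards [hSae] with p hp
      rw [← hp]
      ring
    have hcc : Integrable (fun p : ℝ × ℝ => Real.log (2 * logCapacity γ) / 2 *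
        (Real.cos ((k : ℕ) * p.1) * Real.cos ((l : ℕ) * p.2))) (m.prod m) :=
      integrable_mul_cos_mul_cos (integrable_const _) k l
    rw [h1, integral_sub hcc ((integrable_mul_cos_mul_cos hΛint k l).const_mul _),
      integral_const_mul, integral_const_mul, integral_prod_cos_mul_cos_eq_zero,
      arcGrunskyCoeff_eq_integral_prod hγ hz]
    have hπ := Real.pi_ne_zero
    field_simp
    ring
  -- By orthogonality the projection is already exact as soon as the partial sum contains `(k, l)`;
  -- uniform convergence then compares it with that of `S`.
  have hpartial : ∀ F : Finset (ℕ+ × ℕ+), (k, l) ∈ F →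
      ∫ p : ℝ × ℝ, (∑ kl ∈ F, a kl.1 kl.2 * (Real.cos ((kl.1 : ℕ) * p.1) *
          Real.cos ((kl.2 : ℕ) * p.2))) *
        (Real.cos ((k : ℕ) * p.1) * Real.cos ((l : ℕ) * p.2)) ∂(m.prod m) =
      Real.pi ^ 2 / 4 * a k l := by
    intro F hF
    simp only [Finset.sum_mul, mul_assoc (a _ _)]
    rw [integral_finsetSum]
    · simp only [integral_const_mul, hm, integral_prod_cos_mul_cos]
      rw [Finset.sum_eq_single_of_mem (k, l) hF fun b _ hb => by simp [hb]]
      simp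
      ring
    · intro kl _
      refine Integrable.const_mul (integrable_mul_cos_mul_cos ?_ k l) _
      have := integrable_mul_cos_mul_cos (integrable_const (μ := m.prod m) (1 : ℝ)) kl.1 kl.2
      simpa only [one_mul] using this
  have hsumint : ∀ F : Finset (ℕ+ × ℕ+), Integrable (fun p : ℝ × ℝ =>
      ∑ kl ∈ F, a kl.1 kl.2 * (Real.cos ((kl.1 : ℕ) * p.1) *
          Real.cos ((kl.2 : ℕ) * p.2))) (m.prod m) := fun F =>
    integrable_finsetSum _ fun kl _ =>
      integrable_mul_cos_mul_cos (integrable_const (μ := m.prod m) (a kl.1 kl.2)) kl.1 kl.2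
  have hclose : ∀ ε > 0, |Real.pi ^ 2 / 4 * arcGrunskyCoeff z k l - Real.pi ^ 2 / 4 * a k l| ≤
      ε * (m.prod m).real univ := by
    intro ε hε
    have hev := (Metric.tendstoUniformlyOn_iff.1 hS.tendstoUniformlyOn ε hε).and
      (eventually_ge_atTop {(k, l)})
    obtain ⟨F, hF, hkl⟩ := hev.exists
    rw [← hJ, ← hpartial F (by simpa using hkl),
      ← integral_sub (integrable_mul_cos_mul_cos hSint k l)
        (integrable_mul_cos_mul_cos (hsumint F) k l), ← Real.norm_eq_abs]
    refine norm_integral_le_of_norm_le_const (μ := m.prod m) ?_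
    filter_upwards [hne] with p hp
    have hd := hF (Real.cos p.1, Real.cos p.2)
      ⟨Real.cos_mem_Icc p.1, Real.cos_mem_Icc p.2, hp⟩
    rw [Real.dist_eq] at hd
    simp only [Polynomial.Chebyshev.T_real_cos, Int.cast_natCast, mul_assoc (a _ _)] at hd
    rw [← sub_mul, norm_mul, norm_mul]
    calc _ ≤ ε * 1 := mul_le_mul hd.le (mul_le_one₀ (Real.abs_cos_le_one _) (norm_nonneg _)
            (Real.abs_cos_le_one _)) (by positivity) hε.le
      _ = ε := mul_one ε
  have hzero : |Real.pi ^ 2 / 4 * arcGrunskyCoeff z k l - Real.pi ^ 2 / 4 * a k l| ≤ 0 := by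
    refine ge_of_tendsto (x := 𝓝[>] (0 : ℝ))
      (f := fun ε => ε * (m.prod m).real univ) ?_ ?_
    · have : Tendsto (fun ε : ℝ => ε * (m.prod m).real univ) (𝓝 0) (𝓝 (0 * (m.prod m).real univ)) :=
        (by fun_prop : Continuous fun ε : ℝ => ε * (m.prod m).real univ).tendsto 0
      rw [zero_mul] at this
      exact this.mono_left nhdsWithin_le_nhds
    · filter_upwards [self_mem_nhdsWithin] with ε hε using hclose ε hε
  have := sub_eq_zero.1 (abs_eq_zero.1 (le_antisymm hzero (abs_nonneg _)))
  have hπ : Real.pi ^ 2 / 4 ≠ 0 := by positivity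
  exact (mul_left_cancel₀ hπ this).symm

end

/-! ### Matrix operators on `ℓ²` -/

section MatrixOperator

variable {𝕜 : Type*} [RCLike 𝕜] {M : ℕ+ → ℕ+ → ℝ}
  {B : lp (fun _ : ℕ+ => 𝕜) 2 →ₗ[𝕜] lp (fun _ : ℕ+ => 𝕜) 2}

/-- A matrix operator defined on all of `ℓ²` is bounded. -/
lemma continuous_of_hasSum_matrix
    (hB : ∀ (x : lp (fun _ : ℕ+ => 𝕜) 2) (k : ℕ+), HasSum (fun l => (M k l : 𝕜) * x l) (B x k)) :
    Continuous B := by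
  have hrow : ∀ k : ℕ+, Continuous fun x => B x k := by
    intro k
    -- Each row functional is a pointwise limit of continuous ones, hence continuous by
    -- Banach–Steinhaus; the closed graph theorem then handles `B`.
    have ht : Tendsto (fun (F : Finset ℕ+) (x : lp (fun _ : ℕ+ => 𝕜) 2) =>
        (∑ l ∈ F, (M k l : 𝕜) • lp.evalCLM 𝕜 (fun _ : ℕ+ => 𝕜) 2 l) x) atTop
        (𝓝 fun x => B x k) := by
      rw [tendsto_pi_nhds]
      intro x
      refine (hB x k).congr fun F => ?_
      simp [lp.evalCLM, RCLike.real_smul_eq_coe_mul]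
    exact (continuousLinearMapOfTendsto _ ht).continuous
  refine B.continuous_of_seq_closed_graph fun u x y hu hBu => ?_
  ext k
  have h1 : Tendsto (fun n => B (u n) k) atTop (𝓝 (B x k)) := ((hrow k).tendsto x).comp hu
  have h2 : Tendsto (fun n => B (u n) k) atTop (𝓝 (y k)) :=
    ((lp.evalCLM 𝕜 (fun _ : ℕ+ => 𝕜) 2 k).continuous.tendsto y).comp hBu
  exact tendsto_nhds_unique h2 h1

/-- The truncation of a sequence to a finite set of indices. -/
noncomputable def truncate (F : Finset ℕ+) (x : lp (fun _ : ℕ+ => 𝕜) 2) : lp (fun _ : ℕ+ => 𝕜) 2 :=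
  ∑ i ∈ F, lp.single 2 i (x i)

lemma tendsto_truncate (x : lp (fun _ : ℕ+ => 𝕜) 2) :
    Tendsto (fun F => truncate F x) atTop (𝓝 x) :=
  lp.hasSum_single (by norm_num) x

lemma apply_truncate
    (hB : ∀ (x : lp (fun _ : ℕ+ => 𝕜) 2) (k : ℕ+), HasSum (fun l => (M k l : 𝕜) * x l) (B x k))
    (F : Finset ℕ+) (x : lp (fun _ : ℕ+ => 𝕜) 2) (k : ℕ+) :
    B (truncate F x) k = ∑ l ∈ F, (M k l : 𝕜) * x l := by
  have hsingle : ∀ l : ℕ+, B (lp.single 2 l (x l)) k = (M k l : 𝕜) * x l := by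
    intro l
    have h := hasSum_single (f := fun j => (M k j : 𝕜) *
      (lp.single 2 l (x l) : lp (fun _ : ℕ+ => 𝕜) 2) j) l fun j hj => by
        simp [lp.single_apply, Pi.single_eq_of_ne hj]
    simpa [lp.single_apply] using (hB _ k).unique h
  rw [truncate, map_sum]
  simp only [lp.coeFn_sum, Finset.sum_apply, hsingle]

lemma inner_truncate (F : Finset ℕ+) (x y : lp (fun _ : ℕ+ => 𝕜) 2) :
    inner 𝕜 x (truncate F y) = ∑ i ∈ F, inner 𝕜 (x i) (y i) := by
  simp only [truncate, inner_sum, lp.inner_single_right]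

lemma isSymmetric_of_hasSum_matrix (hM : ∀ k l, M k l = M l k)
    (hB : ∀ (x : lp (fun _ : ℕ+ => 𝕜) 2) (k : ℕ+), HasSum (fun l => (M k l : 𝕜) * x l) (B x k)) :
    B.IsSymmetric := by
  have hcont := continuous_of_hasSum_matrix hB
  intro x y
  have hl : Tendsto (fun F => inner 𝕜 (B (truncate F x)) (truncate F y)) atTop
      (𝓝 (inner 𝕜 (B x) y)) :=
    ((hcont.tendsto x).comp (tendsto_truncate x)).inner (tendsto_truncate y)
  have hr : Tendsto (fun F => inner 𝕜 (truncate F x) (B (truncate F y))) atTop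
      (𝓝 (inner 𝕜 x (B y))) :=
    (tendsto_truncate x).inner ((hcont.tendsto y).comp (tendsto_truncate y))
  refine tendsto_nhds_unique hl (hr.congr fun F => ?_)
  rw [← inner_conj_symm, inner_truncate, inner_truncate, map_sum]
  simp only [apply_truncate hB, sum_inner, map_sum, inner_conj_symm]
  rw [Finset.sum_comm]
  refine Finset.sum_congr rfl fun i _ => Finset.sum_congr rfl fun j _ => ?_
  simp only [RCLike.inner_apply, map_mul, RCLike.conj_ofReal, hM j i]
  ring

/-- For real entries, the real part of the form at `x` is its value at `Re x` plus its value at `Im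
x`; the mixed terms are purely imaginary. -/
lemma re_inner_add_self_nonneg
    (hpos : ∀ (F : Finset ℕ+) (x : ℕ+ → ℝ),
      0 ≤ ∑ k ∈ F, ∑ l ∈ F, ((if k = l then 1 else 0) + M k l) * x k * x l)
    (hB : ∀ (x : lp (fun _ : ℕ+ => 𝕜) 2) (k : ℕ+), HasSum (fun l => (M k l : 𝕜) * x l) (B x k))
    (x : lp (fun _ : ℕ+ => 𝕜) 2) : 0 ≤ RCLike.re (inner 𝕜 (B x + x) x) := by
  have hcont := continuous_of_hasSum_matrix hB
  -- The summand `x` may stay untruncated: pairing with `truncate F x` sees only its coordinates in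
  -- `F`.
  have hl : Tendsto (fun F => RCLike.re (inner 𝕜 (B (truncate F x) + x) (truncate F x))) atTop
      (𝓝 (RCLike.re (inner 𝕜 (B x + x) x))) :=
    (RCLike.continuous_re.tendsto _).comp
      ((((hcont.tendsto x).comp (tendsto_truncate x)).add_const x).inner (tendsto_truncate x))
  refine ge_of_tendsto' hl fun F => ?_
  have hsum : RCLike.re (inner 𝕜 (B (truncate F x) + x) (truncate F x)) =
      (∑ k ∈ F, ∑ l ∈ F, ((if k = l then 1 else 0) + M k l) * RCLike.re (x k) * RCLike.re (x l)) +
      ∑ k ∈ F, ∑ l ∈ F, ((if k = l then 1 else 0) + M k l) * RCLike.im (x k) * RCLike.im (x l) := by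
    rw [inner_truncate, map_sum, ← Finset.sum_add_distrib]
    refine Finset.sum_congr rfl fun k hk => ?_
    rw [lp.coeFn_add, Pi.add_apply, apply_truncate hB, inner_add_left, sum_inner, map_add, map_sum]
    simp only [add_mul, Finset.sum_add_distrib, ite_mul, one_mul, zero_mul, Finset.sum_ite_eq, hk,
      if_true]
    rw [add_comm, add_add_add_comm, ← Finset.sum_add_distrib]
    congr 1
    · rw [inner_self_eq_norm_sq, RCLike.norm_sq_eq_def]
    · refine Finset.sum_congr rfl fun l _ => ?_
      simp [RCLike.inner_apply, RCLike.mul_re]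
      ring
  rw [hsum]
  exact add_nonneg (hpos F _) (hpos F _)

end MatrixOperator

end ArcGrunsky

/-! ### The main theorem -/

theorem mainTheorem8 {𝕜 : Type*} [RCLike 𝕜] {α : ℝ} (hα : 0 < α) {p q : ℂ} {γ : Set ℂ}
    (hγ : ArcGrunsky.IsHolderJordanArc 3 α p q γ) {z : ℝ → ℂ}
    (hz : ArcGrunsky.IsEquilibriumParametrization p q γ z) :
    -- the coefficients of the arc-Grunsky expansion are the entries used below
    (∀ a : ℕ+ → ℕ+ → ℝ, ArcGrunsky.IsArcGrunskyExpansion γ z a →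
      ∀ k l : ℕ+, a k l = ArcGrunsky.arcGrunskyCoeff z k l) ∧
    -- `B ≥ -I` as a quadratic form on finitely supported sequences
    (∀ x : ℕ+ →₀ ℝ,
      0 ≤ ∑ k ∈ x.support, ∑ l ∈ x.support,
        ((if k = l then 1 else 0) + ArcGrunsky.arcGrunskyMatrix z k l) * x k * x l) ∧
    -- `B ≥ -I` for the operator on `ℓ²`, and all its eigenvalues are real and at least `-1`
    (∀ B : lp (fun _ : ℕ+ => 𝕜) 2 →ₗ[𝕜] lp (fun _ : ℕ+ => 𝕜) 2,
      ArcGrunsky.IsArcGrunskyOperator z B →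
        -LinearMap.id ≤ B ∧
        ∀ μ : 𝕜, Module.End.HasEigenvalue B μ →
          ∃ r : ℝ, μ = (r : 𝕜) ∧ -1 ≤ r) := by
  refine ⟨fun a ha k l => ArcGrunsky.eq_arcGrunskyCoeff_of_isArcGrunskyExpansion hγ hz ha k l,
    fun x => ArcGrunsky.quadraticForm_nonneg hγ hz x.support x, fun B hB => ?_⟩
  have hsymm := ArcGrunsky.isSymmetric_of_hasSum_matrix
    (ArcGrunsky.arcGrunskyMatrix_symm hγ hz) hB
  have hpos := ArcGrunsky.re_inner_add_self_nonneg (ArcGrunsky.quadraticForm_nonneg hγ hz) hB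
  refine ⟨?_, fun μ hμ => ⟨RCLike.re μ, ?_, ?_⟩⟩
  · rw [LinearMap.le_def, sub_neg_eq_add]
    exact ⟨hsymm.add LinearMap.IsSymmetric.id, hpos⟩
  · exact (RCLike.conj_eq_iff_re.1 (hsymm.conj_eigenvalue_eq_self hμ)).symm
  · obtain ⟨x, hx⟩ := hμ.exists_hasEigenvector
    -- At an eigenvector the form equals `(Re μ + 1) ‖x‖²`.
    have h := hpos x
    rw [hx.apply_eq_smul, inner_add_left, inner_smul_left, inner_self_eq_norm_sq_to_K, map_add,
      ← RCLike.ofReal_pow, RCLike.re_mul_ofReal, RCLike.conj_re, RCLike.ofReal_re] at h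
    have hx0 : 0 < ‖x‖ ^ 2 := by
      have := norm_pos_iff.2 hx.2
      positivity
    nlinarith
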